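/- Let $(\Omega,\mathcal F,\mathsf P)$ be a probability space, let $T>0$, and let $\mathsf L_0$ be the space of (equivalence classes of) real random variables with convergence in probability. Let $\mu$ be a stochastic measure on the Borel subsets of $[0,T]$, that is, a map $\mu:\mathcal B([0,T])\to\mathsf L_0$ such that $\mu\bigl(\bigcup_{i\ge1}A_i\bigr)=\sum_{i\ge1}\mu(A_i)$, with convergence in probability, for all pairwise disjoint Borel sets $A_1,A_2,\dots\subseteq[0,T]$. Assume that the process $\mu_t=\mu((0,t])$, $0\le t\le T$, has continuous paths (that is, $(\mu_t)$ denotes a version with almost surely continuous paths). Let $V_t$, $0\le t\le T$, be a real-valued process whose paths are almost surely continuous and of bounded variation on $[0,T]$, and let $f:\mathbb R^2\to\mathbb R$ be of class $\mathbb C^{1,1}(\mathbb R^2)$, i.e. both first-order partial derivatives of $f$ exist and are continuous on $\mathbb R^2$. Put $F(x,v)=\int_0^x f(y,v)\,dy$. Then the partial derivative $F_2'(x,v)=\partial F(x,v)/\partial v$ exists for all $(x,v)$, for almost every $\omega$ the pathwise Riemann–Stieltjes integral $\int_{(0,T]}F_2'(\mu_t,V_t)\,dV_t$ exists, and the symmetric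 integral of $f(\mu_t,V_t)$ with respect to $\mu_t$ is well defined: there is a random variable, denoted $\int_{(0,T]}f(\mu_t,V_t)\circ d\mu_t$, such that for every sequence of partitions $0=t_0^n<t_1^n<\dots<t_{j_n}^n=T$ with $\max_k|t_k^n-t_{k-1}^n|\to0$ as $n\to\infty$, $$\sum_{k=1}^{j_n}\frac{f(\mu_{t_{k-1}^n},V_{t_{k-1}^n})+f(\mu_{t_k^n},V_{t_k^n})}{2}\,\bigl(\mu_{t_k^n}-\mu_{t_{k-1}^n}\bigr)\longrightarrow\int_{(0,T]}f(\mu_t,V_t)\circ d\mu_t\quad\text{in probability.}$$ Moreover, almost surely, $$\int_{(0,T]}f(\mu_t,V_t)\circ d\mu_t=F(\mu_T,V_T)-F(\mu_0,V_0)-\int_{(0,T]}F_2'(\mu_t,V_t)\,dV_t .$$ -/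

import Mathlib

open MeasureTheory Filter Set

noncomputable section

/-- A (general) stochastic measure on a measurable space `X`: a map from measurable sets to the
space `L₀(Ω, P)` of classes of real random variables which is `σ`-additive, the series converging
in probability. (Values on non-measurable sets play no role. Taking all sets empty gives
`μ ∅ = 0`, so finite additivity is included.) -/
def IsStochasticMeasure {Ω : Type*} [MeasurableSpace Ω] (P : Measure Ω)
    {X : Type*} [MeasurableSpace X] (μ : Set X → (Ω →ₘ[P] ℝ)) : Prop :=
  ∀ A : ℕ → Set X, (∀ n, MeasurableSet (A n)) → Pairwise (fun i j => Disjoint (A i) (A j)) →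
    TendstoInMeasure P (fun (n : ℕ) (ω : Ω) => ∑ i ∈ Finset.range n, μ (A i) ω) atTop
      (fun ω => μ (⋃ i, A i) ω)

/-- `m` is a version, with (almost surely) continuous paths on `[0, T]`, of the process
`t ↦ μ ((0, t])`. -/
def IsContinuousVersion {Ω : Type*} [MeasurableSpace Ω] (P : Measure Ω) (T : ℝ)
    (μ : Set (Icc (0 : ℝ) T) → (Ω →ₘ[P] ℝ)) (m : ℝ → Ω → ℝ) : Prop :=
  (∀ t ∈ Icc (0 : ℝ) T,
    m t =ᵐ[P] fun ω => μ {s : Icc (0 : ℝ) T | 0 < (s : ℝ) ∧ (s : ℝ) ≤ t} ω) ∧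
  ∀ᵐ ω ∂P, ContinuousOn (fun t => m t ω) (Icc 0 T)

/-- `V` is a process on `[0, T]` whose paths are (almost surely) continuous and of bounded
variation. -/
def IsContinuousBVProcess {Ω : Type*} [MeasurableSpace Ω] (P : Measure Ω) (T : ℝ)
    (V : ℝ → Ω → ℝ) : Prop :=
  (∀ t ∈ Icc (0 : ℝ) T, AEMeasurable (V t) P) ∧
  ∀ᵐ ω ∂P, ContinuousOn (fun t => V t ω) (Icc 0 T) ∧
    BoundedVariationOn (fun t => V t ω) (Icc 0 T)

/-- A sequence of partitions `0 = t₀ⁿ < t₁ⁿ < ⋯ < t_{jₙ}ⁿ = T` of `[0, T]` whose mesh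
`max_k |t_kⁿ - t_{k-1}ⁿ|` tends to `0`. The values `pt n k` with `k > j n` play no role. -/
structure PartitionSeq (T : ℝ) where
  j : ℕ → ℕ
  pt : ℕ → ℕ → ℝ
  pt_zero : ∀ n, pt n 0 = 0
  pt_last : ∀ n, pt n (j n) = T
  pt_lt : ∀ n, ∀ k < j n, pt n k < pt n (k + 1)
  mesh : ∀ ε > 0, ∀ᶠ n in atTop, ∀ k < j n, pt n (k + 1) - pt n k < ε

/-- The symmetric (trapezoidal) sum
`∑_{k=1}^{jₙ} (ξ_{t_{k-1}ⁿ} + ξ_{t_kⁿ}) / 2 * (η_{t_kⁿ} - η_{t_{k-1}ⁿ})`. -/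
def symmetricSum {Ω : Type*} {T : ℝ} (π : PartitionSeq T) (ξ η : ℝ → Ω → ℝ) (n : ℕ) (ω : Ω) : ℝ :=
  ∑ k ∈ Finset.range (π.j n),
    (ξ (π.pt n k) ω + ξ (π.pt n (k + 1)) ω) / 2 * (η (π.pt n (k + 1)) ω - η (π.pt n k) ω)

/-- The integral `∫_{(0,T]} ξ_t ∘ dη_t` is well defined and equals the random variable `I`: along
every sequence of partitions with mesh tending to `0` the symmetric sums converge in probability
to `I`. -/
def HasStratonovichIntegral {Ω : Type*} [MeasurableSpace Ω] (P : Measure Ω) (T : ℝ)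
    (ξ η : ℝ → Ω → ℝ) (I : Ω → ℝ) : Prop :=
  AEMeasurable I P ∧
  ∀ π : PartitionSeq T, TendstoInMeasure P (fun n => symmetricSum π ξ η n) atTop I

/-- The Riemann–Stieltjes integral `∫_a^b g dv` exists and equals `I`: the sums
`∑ g(s_k) (v(x_{k+1}) - v(x_k))`, `s_k ∈ [x_k, x_{k+1}]`, over tagged partitions
`a = x₀ ≤ x₁ ≤ ⋯ ≤ x_N = b` converge to `I` as the mesh tends to `0`. -/
def HasStieltjesIntegral (g v : ℝ → ℝ) (a b I : ℝ) : Prop :=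
  ∀ ε > 0, ∃ δ > 0, ∀ (N : ℕ) (x s : ℕ → ℝ), x 0 = a → x N = b →
    (∀ k < N, x k ≤ s k ∧ s k ≤ x (k + 1) ∧ x (k + 1) - x k < δ) →
    |∑ k ∈ Finset.range N, g (s k) * (v (x (k + 1)) - v (x k)) - I| < ε

/-- `F(x, v) = ∫₀ˣ f(y, v) dy`. -/
def primitiveFst (f : ℝ × ℝ → ℝ) (x v : ℝ) : ℝ := ∫ y in (0 : ℝ)..x, f (y, v)

/-- `F₂'(x, v)`, the partial derivative of `F(x, v) = ∫₀ˣ f(y, v) dy` in the second variable. -/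
def primitiveFstDerivSnd (f : ℝ × ℝ → ℝ) (x v : ℝ) : ℝ := deriv (fun w => primitiveFst f x w) v

end

open MeasureTheory Filter Set

noncomputable section

/-! The first half of the argument is pathwise. On one partition interval, the trapezoid for `f(μ,
V)` and the increment of `F(μ, V)` minus `F₂' ΔV` differ by `o(1) * ((Δμ)² + |ΔV|)`. Indeed, the
trapezoidal rule for a function of class C¹ in `x` errs by the oscillation of its derivative times
`(Δμ)²`, and everything that comes from moving `v` is charged to `|ΔV|`, whose sum is at most the
total variation. Hence the sums differ from the right-hand side by at most `ε * (1 + ∑ (Δμ)²)` for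
small mesh (`exists_mesh_abs_trapezoidSum_sub_le`). Divided by `1 + ∑ (Δμ)²` the error tends to zero
almost surely, so convergence in probability follows once `∑ (Δμ)²` is bounded in probability along
the partitions (`tendsto_measureReal_of_div_tendsto`).

The sums of squares are controlled by randomization. By Paley–Zygmund, if `∑ μ(A_i)²` is large at
`ω`, then a uniformly random sub-union of the `A_i` has a large value at `ω` with probability at
least 1/12 (`IsStochasticMeasure.sum_sq_boundedInProbability`). This reduces the claim to
boundedness in probability of the range of `μ`, which is the hard part, since `L₀` is not locally
convex (`IsStochasticMeasure.boundedInProbability`).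

For that, call an event coverable over `E` if, up to small probability, each of its points sees some
`|μ(A_i)| > L 2^i` with `A_i ⊆ E`, the family being finite. This is stable under countable unions of
events, so an event of maximal probability exists, and off it the values are bounded in probability.
Suppose that the maximal event over the whole space has positive probability. Weights `2^{-(i+1)}`
and a random choice of signs 0 or 1 turn the covering family into one convex combination that is
large on a fixed fraction of the event; rounding it to a random set yields one set that is large
there (`CoverableByLargeValues.exists_large`). Splitting `E` repeatedly gives a finite partition
with many large parts at many `ω`, while almost every `ω` of the event keeps a part over which it is
coverable. A sparse random union of parts is then still large with fixed probability, but destroys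
coverability on only a small fraction of the event (`CoverableByLargeValues.exists_remove`).
Iteration with summable losses produces disjoint sets whose values do not tend to zero in
probability, against σ-additivity. -/

/-- The average of `φ` over the random subset of `s` that contains each `i ∈ s` independently with
probability `p i`. -/
def randomSubsetAvg {ι : Type*} [DecidableEq ι] (p : ι → ℝ) (s : Finset ι)
    (φ : Finset ι → ℝ) : ℝ :=
  ∑ t ∈ s.powerset, ((∏ i ∈ t, p i) * ∏ i ∈ s \ t, (1 - p i)) * φ t

/-! ### Random subset sums: moments, Paley–Zygmund, rounding, anti-concentration. -/

section RandomSubset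

variable {ι : Type*} [DecidableEq ι]

lemma randomSubsetAvg_empty (p : ι → ℝ) (φ : Finset ι → ℝ) :
    randomSubsetAvg p ∅ φ = φ ∅ := by
  simp [randomSubsetAvg]

lemma randomSubsetAvg_insert (p : ι → ℝ) {a : ι} {s : Finset ι} (ha : a ∉ s)
    (φ : Finset ι → ℝ) :
    randomSubsetAvg p (insert a s) φ =
      (1 - p a) * randomSubsetAvg p s φ + p a * randomSubsetAvg p s (fun t => φ (insert a t)) := by
  unfold randomSubsetAvg
  rw [Finset.sum_powerset_insert ha, Finset.mul_sum, Finset.mul_sum]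
  congr 1
  · refine Finset.sum_congr rfl fun t ht => ?_
    have hat : a ∉ t := fun h => ha (Finset.mem_powerset.1 ht h)
    rw [Finset.insert_sdiff_of_notMem _ hat, Finset.prod_insert (by simp [ha])]
    ring
  · refine Finset.sum_congr rfl fun t ht => ?_
    have hat : a ∉ t := fun h => ha (Finset.mem_powerset.1 ht h)
    rw [Finset.prod_insert hat, Finset.insert_sdiff_insert,
      Finset.sdiff_insert_of_notMem ha]
    ring

lemma randomSubsetAvg_congr (p : ι → ℝ) (s : Finset ι) {φ ψ : Finset ι → ℝ}
    (h : ∀ t ⊆ s, φ t = ψ t) : randomSubsetAvg p s φ = randomSubsetAvg p s ψ :=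
  Finset.sum_congr rfl fun t ht => by rw [h t (Finset.mem_powerset.1 ht)]

lemma randomSubsetAvg_const (p : ι → ℝ) (s : Finset ι) (c : ℝ) :
    randomSubsetAvg p s (fun _ => c) = c := by
  induction s using Finset.induction_on with
  | empty => simp [randomSubsetAvg_empty]
  | insert a s ha ih => rw [randomSubsetAvg_insert p ha, ih]; ring

lemma randomSubsetAvg_add (p : ι → ℝ) (s : Finset ι) (φ ψ : Finset ι → ℝ) :
    randomSubsetAvg p s (fun t => φ t + ψ t) = randomSubsetAvg p s φ + randomSubsetAvg p s ψ := by
  simp [randomSubsetAvg, mul_add, Finset.sum_add_distrib]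

lemma randomSubsetAvg_mul (p : ι → ℝ) (s : Finset ι) (c : ℝ) (φ : Finset ι → ℝ) :
    randomSubsetAvg p s (fun t => c * φ t) = c * randomSubsetAvg p s φ := by
  simp only [randomSubsetAvg, Finset.mul_sum]
  exact Finset.sum_congr rfl fun t _ => by ring

lemma randomSubsetAvg_sub (p : ι → ℝ) (s : Finset ι) (φ ψ : Finset ι → ℝ) :
    randomSubsetAvg p s (fun t => φ t - ψ t) = randomSubsetAvg p s φ - randomSubsetAvg p s ψ := by
  simp [randomSubsetAvg, mul_sub, Finset.sum_sub_distrib]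

lemma randomSubset_weight_nonneg {p : ι → ℝ} (hp : ∀ i, 0 ≤ p i ∧ p i ≤ 1) (s t : Finset ι) :
    0 ≤ (∏ i ∈ t, p i) * ∏ i ∈ s \ t, (1 - p i) :=
  mul_nonneg (Finset.prod_nonneg fun i _ => (hp i).1)
    (Finset.prod_nonneg fun i _ => sub_nonneg.2 (hp i).2)

lemma randomSubsetAvg_mono {p : ι → ℝ} (hp : ∀ i, 0 ≤ p i ∧ p i ≤ 1) (s : Finset ι)
    {φ ψ : Finset ι → ℝ} (h : ∀ t ⊆ s, φ t ≤ ψ t) :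
    randomSubsetAvg p s φ ≤ randomSubsetAvg p s ψ :=
  Finset.sum_le_sum fun t ht => mul_le_mul_of_nonneg_left (h t (Finset.mem_powerset.1 ht))
    (randomSubset_weight_nonneg hp s t)

lemma exists_le_of_le_randomSubsetAvg {p : ι → ℝ} (hp : ∀ i, 0 ≤ p i ∧ p i ≤ 1) (s : Finset ι)
    {φ : Finset ι → ℝ} {c : ℝ} (h : c ≤ randomSubsetAvg p s φ) : ∃ t ⊆ s, c ≤ φ t := by
  by_contra! hcon
  obtain ⟨t, hts, hmax⟩ := Finset.exists_max_image s.powerset φ ⟨∅, by simp⟩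
  have h1 : randomSubsetAvg p s φ ≤ randomSubsetAvg p s (fun _ => φ t) :=
    randomSubsetAvg_mono hp s fun u hu => hmax u (Finset.mem_powerset.2 hu)
  rw [randomSubsetAvg_const] at h1
  exact absurd (hcon t (Finset.mem_powerset.1 hts)) (not_lt.2 (h.trans h1))

/-- Recursion for averages of functions of the random sum `∑ i ∈ t, x i`. -/
lemma randomSubsetAvg_sum_insert (p x : ι → ℝ) {a : ι} {s : Finset ι} (ha : a ∉ s) (h : ℝ → ℝ) :
    randomSubsetAvg p (insert a s) (fun t => h (∑ i ∈ t, x i)) =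
      (1 - p a) * randomSubsetAvg p s (fun t => h (∑ i ∈ t, x i)) +
        p a * randomSubsetAvg p s (fun t => h (x a + ∑ i ∈ t, x i)) := by
  rw [randomSubsetAvg_insert p ha]
  congr 2
  refine randomSubsetAvg_congr p s fun t ht => ?_
  rw [Finset.sum_insert fun h' => ha (ht h')]

/-- Second moment of a sum of independent terms: squared mean plus variance. The shift `c` is
carried so that the induction can condition on whether `a` is chosen. -/
lemma randomSubsetAvg_sq (p x : ι → ℝ) (s : Finset ι) (c : ℝ) :
    randomSubsetAvg p s (fun t => (c + ∑ i ∈ t, x i) ^ 2) =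
      (c + ∑ i ∈ s, p i * x i) ^ 2 + ∑ i ∈ s, p i * (1 - p i) * x i ^ 2 := by
  induction s using Finset.induction_on generalizing c with
  | empty => simp [randomSubsetAvg_empty]
  | insert a s ha ih =>
    rw [randomSubsetAvg_sum_insert p x ha (fun y => (c + y) ^ 2)]
    simp only [← add_assoc]
    rw [ih, ih, Finset.sum_insert ha, Finset.sum_insert ha]
    ring

/-- The random sum is its mean plus independent symmetric signs times `x i / 2`; the bound is the
Gaussian fourth moment with the same mean and variance. -/
lemma randomSubsetAvg_pow_four_le (x : ι → ℝ) (s : Finset ι) (c : ℝ) :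
    randomSubsetAvg (fun _ => 1 / 2) s (fun t => (c + ∑ i ∈ t, x i) ^ 4) ≤
      (c + ∑ i ∈ s, x i / 2) ^ 4 + 6 * (c + ∑ i ∈ s, x i / 2) ^ 2 * ∑ i ∈ s, (x i / 2) ^ 2 +
        3 * (∑ i ∈ s, (x i / 2) ^ 2) ^ 2 := by
  induction s using Finset.induction_on generalizing c with
  | empty => simp [randomSubsetAvg_empty]
  | insert a s ha ih =>
    rw [randomSubsetAvg_sum_insert _ x ha (fun y => (c + y) ^ 4)]
    simp only [← add_assoc]
    have h1 := ih c
    have h2 := ih (c + x a)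
    rw [Finset.sum_insert ha, Finset.sum_insert ha]
    set q := ∑ i ∈ s, (x i / 2) ^ 2
    set r := ∑ i ∈ s, x i / 2
    -- The target exceeds the average of the two inductive bounds by exactly `2 * (x a / 2) ^ 4`.
    nlinarith [sq_nonneg (x a ^ 2)]

open Classical in
/-- Paley–Zygmund inequality for a random subset sum. -/
lemma randomSubsetAvg_paleyZygmund (x : ι → ℝ) (s : Finset ι) :
    1 / 12 ≤ randomSubsetAvg (fun _ => 1 / 2) s (fun t =>
      if ((∑ i ∈ s, x i / 2) ^ 2 + ∑ i ∈ s, (x i / 2) ^ 2) / 2 ≤ (∑ i ∈ t, x i) ^ 2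
      then 1 else 0) := by
  have hp : ∀ i : ι, (0 : ℝ) ≤ (fun _ => 1 / 2 : ι → ℝ) i ∧ (fun _ => 1 / 2 : ι → ℝ) i ≤ 1 := by
    intro i; norm_num
  have h2 := randomSubsetAvg_sq (fun _ => 1 / 2) x s 0
  have h4 := randomSubsetAvg_pow_four_le x s 0
  simp only [zero_add] at h2 h4
  have e1 : ∑ i ∈ s, 1 / 2 * x i = ∑ i ∈ s, x i / 2 := Finset.sum_congr rfl fun i _ => by ring
  have e2 : ∑ i ∈ s, (1 / 2 : ℝ) * (1 - 1 / 2) * x i ^ 2 = ∑ i ∈ s, (x i / 2) ^ 2 :=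
    Finset.sum_congr rfl fun i _ => by ring
  rw [e1, e2] at h2
  have hq : 0 ≤ ∑ i ∈ s, (x i / 2) ^ 2 := Finset.sum_nonneg fun i _ => sq_nonneg _
  set q := ∑ i ∈ s, (x i / 2) ^ 2
  set r := ∑ i ∈ s, x i / 2
  set M := r ^ 2 + q with hM
  have hM0 : 0 ≤ M := by positivity
  rcases hM0.eq_or_lt with hz | hpos
  · rw [← hz]
    have : ∀ t : Finset ι, (if (0 : ℝ) / 2 ≤ (∑ i ∈ t, x i) ^ 2 then (1 : ℝ) else 0) = 1 := by
      intro t; rw [if_pos]; rw [zero_div]; positivity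
    simp only [this, randomSubsetAvg_const]; norm_num
  -- Where `z ^ 2 ≥ M / 2`, the inequality `z ^ 2 ≤ z ^ 4 / (12 * M) + 3 * M` is AM-GM. As the
  -- fourth moment is at most `3 * M ^ 2`, averaging gives `M ≤ M / 2 + M / 4 + 3 * M * A`, that is
  -- `A ≥ 1 / 12`.
  have key : randomSubsetAvg (fun _ => 1 / 2) s (fun t => (∑ i ∈ t, x i) ^ 2) ≤
      randomSubsetAvg (fun _ => 1 / 2) s (fun t => M / 2 + (1 / (12 * M) * (∑ i ∈ t, x i) ^ 4 +
        3 * M * (if M / 2 ≤ (∑ i ∈ t, x i) ^ 2 then (1 : ℝ) else 0))) := by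
    refine randomSubsetAvg_mono hp s fun t _ => ?_
    set z := ∑ i ∈ t, x i
    have hz4 : 1 / (12 * M) * z ^ 4 = (z ^ 2) ^ 2 / (12 * M) := by ring
    rw [hz4]
    split_ifs with hc
    · have : z ^ 2 ≤ (z ^ 2) ^ 2 / (12 * M) + 3 * M := by
        rw [div_add' _ _ _ (by positivity), le_div_iff₀ (by positivity)]
        nlinarith [sq_nonneg (z ^ 2 - 6 * M)]
      linarith
    · have : 0 ≤ (z ^ 2) ^ 2 / (12 * M) := by positivity
      linarith
  rw [randomSubsetAvg_add, randomSubsetAvg_add, randomSubsetAvg_const, randomSubsetAvg_mul,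
    randomSubsetAvg_mul, h2] at key
  set A := randomSubsetAvg (fun _ => 1 / 2) s (fun t =>
    if M / 2 ≤ (∑ i ∈ t, x i) ^ 2 then (1 : ℝ) else 0)
  have h4' : 1 / (12 * M) * randomSubsetAvg (fun _ => 1 / 2) s (fun t => (∑ i ∈ t, x i) ^ 4) ≤
      M / 4 := by
    rw [one_div_mul_eq_div, div_le_iff₀ (by positivity)]
    refine h4.trans ?_
    rw [hM]
    nlinarith [sq_nonneg (r ^ 2), mul_nonneg (sq_nonneg r) hq]
  have : M / 4 ≤ 3 * M * A := by linarith
  by_contra! hcon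
  nlinarith

open Classical in
/-- A random subset sum, either unbiased or with the prescribed mean `∑ i ∈ s, p i * x i`, is
comparable with that mean with positive probability. -/
lemma randomSubsetAvg_rounding {p : ι → ℝ} (hp : ∀ i, 0 ≤ p i ∧ p i ≤ 1) (x : ι → ℝ)
    (s : Finset ι) {L : ℝ} (hL : 0 ≤ L) (h : L < |∑ i ∈ s, p i * x i|) :
    1 / 12 ≤ randomSubsetAvg (fun _ => 1 / 2) s
        (fun t => if L / 4 < |∑ i ∈ t, x i| then 1 else 0) +
      randomSubsetAvg p s (fun t => if L / 4 < |∑ i ∈ t, x i| then 1 else 0) := by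
  have hhalf : ∀ i : ι, (0 : ℝ) ≤ (fun _ => 1 / 2 : ι → ℝ) i ∧
    (fun _ => 1 / 2 : ι → ℝ) i ≤ 1 := by intro i; norm_num
  set e := ∑ i ∈ s, p i * x i with he
  have he0 : 0 < |e| := hL.trans_lt h
  have he2 : 0 < e ^ 2 := by rw [← sq_abs]; positivity
  have hLe : (L / 4) ^ 2 < e ^ 2 / 16 := by rw [← sq_abs e]; nlinarith
  have nonneg : ∀ q : ι → ℝ, (∀ i, 0 ≤ q i ∧ q i ≤ 1) → 0 ≤ randomSubsetAvg q s
      (fun t => if L / 4 < |∑ i ∈ t, x i| then (1 : ℝ) else 0) := by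
    intro q hq
    exact (randomSubsetAvg_const q s 0).ge.trans
      (randomSubsetAvg_mono hq s fun t _ => by split_ifs <;> norm_num)
  -- If the squares are large compared with `e ^ 2`, the unbiased subset spreads enough by
  -- Paley–Zygmund. Otherwise the variance of the `p`-biased subset is at most `e ^ 2 / 8`, and
  -- Chebyshev keeps its sum within `|e| / 2` of the mean with probability at least 1/2.
  by_cases hQ : e ^ 2 / 2 ≤ ∑ i ∈ s, x i ^ 2
  · have h1 := randomSubsetAvg_paleyZygmund x s
    have h2 : randomSubsetAvg (fun _ => 1 / 2) s (fun t =>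
        if ((∑ i ∈ s, x i / 2) ^ 2 + ∑ i ∈ s, (x i / 2) ^ 2) / 2 ≤ (∑ i ∈ t, x i) ^ 2
        then (1 : ℝ) else 0) ≤ randomSubsetAvg (fun _ => 1 / 2) s
        (fun t => if L / 4 < |∑ i ∈ t, x i| then 1 else 0) := by
      refine randomSubsetAvg_mono hhalf s fun t _ => ?_
      by_cases hc : ((∑ i ∈ s, x i / 2) ^ 2 + ∑ i ∈ s, (x i / 2) ^ 2) / 2 ≤ (∑ i ∈ t, x i) ^ 2
      · have : L / 4 < |∑ i ∈ t, x i| := by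
          have e3 : ∑ i ∈ s, (x i / 2) ^ 2 = (∑ i ∈ s, x i ^ 2) / 4 := by
            rw [Finset.sum_div]; exact Finset.sum_congr rfl fun i _ => by ring
          rw [e3] at hc
          refine lt_of_pow_lt_pow_left₀ 2 (abs_nonneg _) ?_
          rw [sq_abs]
          nlinarith [sq_nonneg (∑ i ∈ s, x i / 2)]
        rw [if_pos hc, if_pos this]
      · rw [if_neg hc]; split_ifs <;> norm_num
    linarith [nonneg p hp]
  · push Not at hQ
    have hvar := randomSubsetAvg_sq p x s (-e)
    rw [← he, neg_add_cancel] at hvar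
    have hv : ∑ i ∈ s, p i * (1 - p i) * x i ^ 2 ≤ e ^ 2 / 8 := by
      calc _ ≤ ∑ i ∈ s, x i ^ 2 / 4 := Finset.sum_le_sum fun i _ => by
            nlinarith [sq_nonneg (p i - 1 / 2), sq_nonneg (x i),
              mul_nonneg (sq_nonneg (p i - 1 / 2)) (sq_nonneg (x i))]
        _ = (∑ i ∈ s, x i ^ 2) / 4 := by rw [Finset.sum_div]
        _ ≤ _ := by linarith
    have key : randomSubsetAvg p s (fun t => (e ^ 2 / 4) *
          (1 - (if L / 4 < |∑ i ∈ t, x i| then (1 : ℝ) else 0))) ≤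
        randomSubsetAvg p s (fun t => (-e + ∑ i ∈ t, x i) ^ 2) := by
      refine randomSubsetAvg_mono hp s fun t _ => ?_
      split_ifs with hc
      · simp only [sub_self, mul_zero]; positivity
      · push Not at hc
        set z := ∑ i ∈ t, x i
        have h1 : |e| ≤ |(-e + z)| + |z| := by
          have := abs_sub z (-e + z)
          have h2 : z - (-e + z) = e := by ring
          rw [h2] at this; linarith
        have h2 : |e| / 2 ≤ |(-e + z)| := by linarith
        rw [← sq_abs (-e + z), ← sq_abs e]
        nlinarith [abs_nonneg e]
    rw [randomSubsetAvg_mul, randomSubsetAvg_sub, randomSubsetAvg_const, hvar] at key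
    have := nonneg _ hhalf
    by_contra! hcon
    have hA : 1 - randomSubsetAvg p s
        (fun t => if L / 4 < |∑ i ∈ t, x i| then (1 : ℝ) else 0) > 11 / 12 := by linarith
    nlinarith

open Classical in
/-- Anti-concentration: a random subset sum with many large terms is large with probability almost
one half. -/
lemma randomSubsetAvg_small_le {q : ℝ} (hq0 : 0 ≤ q) (hq : q ≤ 1 / 2) (x : ι → ℝ) (s : Finset ι)
    (K c : ℝ) :
    randomSubsetAvg (fun _ => q) s (fun t => if |c + ∑ i ∈ t, x i| ≤ K / 2 then 1 else 0) ≤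
      1 / 2 + 1 / 2 * (1 - 2 * q) ^ (s.filter (fun i => K < |x i|)).card := by
  have hp : ∀ i : ι, 0 ≤ (fun _ => q : ι → ℝ) i ∧ (fun _ => q : ι → ℝ) i ≤ 1 := by
    intro i; constructor <;> simp <;> linarith
  induction s using Finset.induction_on generalizing c with
  | empty =>
    simp only [randomSubsetAvg_empty, Finset.filter_empty, Finset.card_empty, pow_zero]
    split_ifs <;> norm_num
  | insert a s ha ih =>
    rw [randomSubsetAvg_sum_insert _ x ha (fun y => if |c + y| ≤ K / 2 then 1 else 0)]
    simp only [← add_assoc]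
    have h1 := ih c
    have h2 := ih (c + x a)
    by_cases hx : K < |x a|
    · rw [Finset.filter_insert, if_pos hx, Finset.card_insert_of_notMem (by simp [ha]), pow_succ]
      -- Two points at distance `|x a| > K` cannot both lie in `[-K / 2, K / 2]`, so the two
      -- probabilities add up to at most 1. Writing the mixture as `q * (sum of both) + (1 - 2 * q)
      -- * (first)` contracts the excess over 1/2 by the factor `1 - 2 * q`.
      have h3 : randomSubsetAvg (fun _ => q) s (fun t =>
            if |c + ∑ i ∈ t, x i| ≤ K / 2 then (1 : ℝ) else 0) +
          randomSubsetAvg (fun _ => q) s (fun t =>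
            if |c + x a + ∑ i ∈ t, x i| ≤ K / 2 then (1 : ℝ) else 0) ≤ 1 := by
        rw [← randomSubsetAvg_add]
        refine (randomSubsetAvg_mono hp s fun t _ => ?_).trans
          (randomSubsetAvg_const (fun _ => q) s 1).le
        split_ifs with h4 h5 <;> try norm_num
        have := abs_sub (c + x a + ∑ i ∈ t, x i) (c + ∑ i ∈ t, x i)
        have e : c + x a + ∑ i ∈ t, x i - (c + ∑ i ∈ t, x i) = x a := by ring
        rw [e] at this
        linarith
      nlinarith
    · rw [Finset.filter_insert, if_neg hx]
      nlinarith

end RandomSubset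

/-! ### Integrating pointwise averages over an event. -/

section Averaging

variable {Ω : Type*} [MeasurableSpace Ω] {P : Measure Ω} [IsProbabilityMeasure P]

-- Integration over `B` of the pointwise bound. This exchange of the two averages turns "for each
-- `ω`, many subsets work" into "some subset works for many `ω`". The weights may be negative.
open Classical in
lemma le_sum_mul_measureReal_inter {ι : Type*} (s : Finset ι) (w : ι → ℝ) {S : ι → Set Ω}
    (hS : ∀ i ∈ s, MeasurableSet (S i)) {B : Set Ω} (hB : MeasurableSet B) {c : ℝ}
    (h : ∀ᵐ ω ∂P, ω ∈ B → c ≤ ∑ i ∈ s, w i * (if ω ∈ S i then 1 else 0)) :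
    c * P.real B ≤ ∑ i ∈ s, w i * P.real (B ∩ S i) := by
  have hint : ∀ i ∈ s, Integrable (fun ω => w i * (S i).indicator (fun _ => (1 : ℝ)) ω)
      (P.restrict B) := fun i hi =>
    ((integrable_const (1 : ℝ)).indicator (hS i hi)).const_mul _
  have h1 : ∫ _ω in B, c ∂P ≤
      ∫ ω in B, ∑ i ∈ s, w i * (S i).indicator (fun _ => (1 : ℝ)) ω ∂P := by
    refine setIntegral_mono_on_ae (by simp) (integrable_finsetSum _ hint) hB ?_
    filter_upwards [h] with ω hω hωB
    simpa only [indicator_apply] using hω hωB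
  rw [integral_finsetSum _ hint] at h1
  simp only [integral_const, measureReal_restrict_apply_univ, smul_eq_mul] at h1
  rw [mul_comm]
  refine h1.trans_eq (Finset.sum_congr rfl fun i hi => ?_)
  rw [integral_const_mul, integral_indicator_const _ (hS i hi), smul_eq_mul, mul_one,
    measureReal_restrict_apply (hS i hi), inter_comm]

open Classical in
lemma le_randomSubsetAvg_measureReal {ι : Type*} [DecidableEq ι] (p : ι → ℝ) (s : Finset ι)
    {S : Finset ι → Set Ω} (hS : ∀ t ⊆ s, MeasurableSet (S t)) {B : Set Ω} (hB : MeasurableSet B)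
    {c : ℝ}
    (h : ∀ᵐ ω ∂P, ω ∈ B → c ≤ randomSubsetAvg p s (fun t => if ω ∈ S t then 1 else 0)) :
    c * P.real B ≤ randomSubsetAvg p s (fun t => P.real (B ∩ S t)) :=
  le_sum_mul_measureReal_inter s.powerset _ (fun t ht => hS t (Finset.mem_powerset.1 ht)) hB h

omit [IsProbabilityMeasure P] in
lemma measurableSet_lt_abs (K : ℝ) (Y : Ω →ₘ[P] ℝ) : MeasurableSet {ω | K < |Y ω|} :=
  measurableSet_lt measurable_const Y.measurable.abs

lemma exists_measureReal_lt_abs_le {Y : Ω → ℝ} (hY : AEMeasurable Y P) {η : ℝ} (hη : 0 < η) :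
    ∃ K, 0 ≤ K ∧ P.real {ω | K < |Y ω|} ≤ η := by
  have hanti : Antitone fun n : ℕ => {ω | (n : ℝ) < |Y ω|} := fun a b hab ω hω => by
    simp only [mem_ofPred_eq] at hω ⊢
    exact lt_of_le_of_lt (Nat.cast_le.2 hab) hω
  have hmeas : ∀ n : ℕ, NullMeasurableSet {ω | (n : ℝ) < |Y ω|} P := fun n =>
    nullMeasurableSet_lt aemeasurable_const hY.abs
  have h := tendsto_measure_iInter_atTop (μ := P) hmeas hanti ⟨0, measure_ne_top _ _⟩
  have he : ⋂ n : ℕ, {ω | (n : ℝ) < |Y ω|} = ∅ := by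
    ext ω
    simp only [mem_iInter, mem_ofPred_eq, mem_empty_iff_false, iff_false, not_forall, not_lt]
    exact exists_nat_ge _
  rw [he, measure_empty] at h
  obtain ⟨n, hn⟩ := (h.eventually (ge_mem_nhds (ENNReal.ofReal_pos.2 hη))).exists
  exact ⟨n, n.cast_nonneg, ENNReal.toReal_le_of_le_ofReal hη.le hn⟩

end Averaging

/-! ### Finite additivity, and vanishing along disjoint sequences. -/

namespace IsStochasticMeasure

variable {Ω : Type*} [MeasurableSpace Ω] {P : Measure Ω} [IsProbabilityMeasure P]
  {X : Type*} [MeasurableSpace X] {μ : Set X → (Ω →ₘ[P] ℝ)}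

/-- Each term is a difference of consecutive partial sums of a series convergent in probability. The
boundedness theorem contradicts exactly this property. -/
lemma tendsto_disjoint (hμ : IsStochasticMeasure P μ) {D : ℕ → Set X}
    (hD : ∀ n, MeasurableSet (D n)) (hdisj : Pairwise (fun i j => Disjoint (D i) (D j)))
    {ε : ℝ} (hε : 0 < ε) :
    Tendsto (fun n => P.real {ω | ε < |μ (D n) ω|}) atTop (nhds 0) := by
  have h := tendstoInMeasure_iff_measureReal_norm.1 (hμ D hD hdisj) (ε / 2) (half_pos hε)
  have h2 := ((tendsto_add_atTop_iff_nat 1).2 h).add h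
  rw [add_zero] at h2
  refine squeeze_zero (fun n => measureReal_nonneg) (fun n => ?_) h2
  refine (measureReal_mono fun ω hω => ?_).trans (measureReal_union_le _ _)
  simp only [mem_union, mem_ofPred_eq, Real.norm_eq_abs] at hω ⊢
  rw [Finset.sum_range_succ]
  set S := ∑ i ∈ Finset.range n, μ (D i) ω
  set I := μ (⋃ i, D i) ω
  by_contra! hcon
  have := abs_sub (S + μ (D n) ω - I) (S - I)
  have e : S + μ (D n) ω - I - (S - I) = μ (D n) ω := by ring
  rw [e] at this
  linarith

lemma apply_empty (hμ : IsStochasticMeasure P μ) : μ ∅ = 0 := by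
  have h : ∀ ε : ℝ, 0 < ε → ∀ᵐ ω ∂P, |μ ∅ ω| ≤ ε := by
    intro ε hε
    have h1 := hμ.tendsto_disjoint (D := fun _ => ∅) (fun _ => MeasurableSet.empty)
      (fun _ _ _ => disjoint_bot_left) hε
    have h2 := tendsto_nhds_unique h1 tendsto_const_nhds
    rw [ae_iff]
    simp only [not_le]
    exact (measureReal_eq_zero_iff).1 h2.symm
  refine AEEqFun.ext ?_
  have h3 : ∀ᵐ ω ∂P, ∀ n : ℕ, |μ ∅ ω| ≤ 1 / ((n : ℝ) + 1) :=
    ae_all_iff.2 fun n => h _ Nat.one_div_pos_of_nat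
  filter_upwards [h3, AEEqFun.coeFn_zero (α := Ω) (β := ℝ) (μ := P)] with ω hω h0
  rw [h0]
  have := ge_of_tendsto' (tendsto_one_div_add_atTop_nhds_zero_nat (𝕜 := ℝ)) hω
  simpa using this

lemma apply_union (hμ : IsStochasticMeasure P μ) {A B : Set X} (hA : MeasurableSet A)
    (hB : MeasurableSet B) (hAB : Disjoint A B) : μ (A ∪ B) = μ A + μ B := by
  let D : ℕ → Set X := fun n => if n = 0 then A else if n = 1 then B else ∅
  have hD : ∀ n, MeasurableSet (D n) := by
    intro n; simp only [D]; split_ifs <;> simp [hA, hB]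
  have hdisj : Pairwise (fun i j => Disjoint (D i) (D j)) := by
    intro i j hij
    simp only [D]
    split_ifs <;> first | omega | exact hAB | exact hAB.symm | simp
  have hU : ⋃ i, D i = A ∪ B := by
    ext x
    simp only [mem_iUnion, mem_union, D]
    constructor
    · rintro ⟨i, hi⟩
      split_ifs at hi
      · exact Or.inl hi
      · exact Or.inr hi
      · exact hi.elim
    · rintro (h | h)
      · exact ⟨0, by simpa using h⟩
      · exact ⟨1, by simpa using h⟩
  have h1 := hμ D hD hdisj
  rw [hU] at h1
  have h2 : TendstoInMeasure P (fun (n : ℕ) (ω : Ω) => ∑ i ∈ Finset.range n, μ (D i) ω) atTop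
      (fun ω => μ A ω + μ B ω) := by
    refine TendstoInMeasure.congr' (f := fun (_ : ℕ) (ω : Ω) => μ A ω + μ B ω)
      (g := fun ω => μ A ω + μ B ω) ?_ EventuallyEq.rfl ?_
    · filter_upwards [eventually_ge_atTop 2] with n hn
      filter_upwards [AEEqFun.coeFn_zero (α := Ω) (β := ℝ) (μ := P)] with ω h0
      obtain ⟨k, rfl⟩ := Nat.exists_eq_add_of_le' hn
      rw [Finset.sum_range_succ', Finset.sum_range_succ']
      simp [D, hμ.apply_empty, h0, add_comm]
    · intro ε hε
      have : ∀ i : ℕ, P {x | ε ≤ edist (μ A x + μ B x) (μ A x + μ B x)} = 0 := by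
        intro _; simp [hε.ne']
      simp only [edist_self, nonpos_iff_eq_zero, hε.ne', ofPred_false, measure_empty]
      exact tendsto_const_nhds
  refine AEEqFun.ext ?_
  filter_upwards [tendstoInMeasure_ae_unique h1 h2, AEEqFun.coeFn_add (μ A) (μ B)] with ω h3 h4
  rw [h3, h4]; rfl

lemma apply_biUnion (hμ : IsStochasticMeasure P μ) {ι : Type*} (s : Finset ι) {A : ι → Set X}
    (hA : ∀ i ∈ s, MeasurableSet (A i)) (hdisj : (s : Set ι).PairwiseDisjoint A) :
    μ (⋃ i ∈ s, A i) = ∑ i ∈ s, μ (A i) := by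
  classical
  induction s using Finset.induction_on with
  | empty => simp [hμ.apply_empty]
  | insert a s ha ih =>
    rw [Finset.set_biUnion_insert, Finset.sum_insert ha, hμ.apply_union (hA a (by simp))
      (s.measurableSet_biUnion fun i hi => hA i (by simp [hi])),
      ih (fun i hi => hA i (by simp [hi])) (hdisj.subset (by simp))]
    refine disjoint_iUnion₂_right.2 fun i hi => ?_
    exact hdisj (by simp) (by simp [hi]) (by rintro rfl; exact ha hi)

lemma ae_apply_biUnion (hμ : IsStochasticMeasure P μ) {ι : Type*} (s : Finset ι)
    {A : ι → Set X} (hA : ∀ i ∈ s, MeasurableSet (A i))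
    (hdisj : (s : Set ι).PairwiseDisjoint A) :
    ∀ᵐ ω ∂P, ∀ t ⊆ s, μ (⋃ i ∈ t, A i) ω = ∑ i ∈ t, μ (A i) ω := by
  have h : ∀ t ∈ s.powerset, ∀ᵐ ω ∂P, μ (⋃ i ∈ t, A i) ω = ∑ i ∈ t, μ (A i) ω := by
    intro t ht
    have hts := Finset.mem_powerset.1 ht
    rw [hμ.apply_biUnion t (fun i hi => hA i (hts hi)) (hdisj.subset (by exact_mod_cast hts))]
    filter_upwards [AEEqFun.coeFn_finsetSum t fun i => μ (A i)] with ω hω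
    rw [hω, Finset.sum_apply]
  filter_upwards [(Finset.eventually_all _).2 h] with ω hω t ht
  exact hω t (Finset.mem_powerset.2 ht)

lemma ae_apply_inter_add_diff (hμ : IsStochasticMeasure P μ) {E A : Set X}
    (hE : MeasurableSet E) (hA : MeasurableSet A) (hAE : A ⊆ E) :
    ∀ᵐ ω ∂P, μ E ω = μ A ω + μ (E \ A) ω := by
  have h := hμ.apply_union hA (hE.diff hA) disjoint_sdiff_right
  rw [union_sdiff_cancel hAE] at h
  filter_upwards [AEEqFun.coeFn_add (μ A) (μ (E \ A))] with ω hω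
  rw [h, hω]; rfl

end IsStochasticMeasure

/-! ### Coverable events and exhaustion. -/

section Coverable

variable {Ω : Type*} [MeasurableSpace Ω] (P : Measure Ω)
  {X : Type*} [MeasurableSpace X] (μ : Set X → (Ω →ₘ[P] ℝ))

/-- Up to small probability, `G` is covered by finitely many of the events that `μ (A i)`, with
`A i ⊆ E`, exceeds a level that grows geometrically with `i`. -/
def CoverableByLargeValues (E : Set X) (G : Set Ω) : Prop :=
  ∀ L η : ℝ, 0 < L → 0 < η → ∃ (m : ℕ) (A : ℕ → Set X), (∀ i, MeasurableSet (A i) ∧ A i ⊆ E) ∧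
    P.real (G \ ⋃ i ∈ Finset.range m, {ω | L * 2 ^ i < |μ (A i) ω|}) ≤ η

/-- The values of `μ` on the measurable subsets of `E` are bounded in probability on `G`. -/
def BoundedInProbabilityOn (E : Set X) (G : Set Ω) : Prop :=
  ∀ η : ℝ, 0 < η → ∃ K : ℝ, ∀ A, MeasurableSet A → A ⊆ E → P.real (G ∩ {ω | K < |μ A ω|}) ≤ η

variable {P μ} [IsProbabilityMeasure P]

lemma exists_measureReal_iUnion_diff_le {T : ℕ → Set Ω} (hT : ∀ i, MeasurableSet (T i))
    {η : ℝ} (hη : 0 < η) :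
    ∃ m, P.real ((⋃ i, T i) \ ⋃ i ∈ Finset.range m, T i) ≤ η := by
  have hm : ∀ m : ℕ, MeasurableSet (⋃ i ∈ Finset.range m, T i) := fun m =>
    Finset.measurableSet_biUnion _ fun i _ => hT i
  have hanti : Antitone fun m : ℕ => (⋃ i, T i) \ ⋃ i ∈ Finset.range m, T i := fun a b hab =>
    sdiff_subset_sdiff_right (biUnion_subset_biUnion_left fun i hi =>
      Finset.mem_range.2 ((Finset.mem_range.1 hi).trans_le hab))
  have h := tendsto_measure_iInter_atTop (μ := P)
    (fun m => ((MeasurableSet.iUnion hT).diff (hm m)).nullMeasurableSet) hanti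
    ⟨0, measure_ne_top _ _⟩
  have he : ⋂ m : ℕ, ((⋃ i, T i) \ ⋃ i ∈ Finset.range m, T i) = ∅ := by
    refine eq_empty_of_forall_notMem fun ω hω => ?_
    rw [mem_iInter] at hω
    obtain ⟨i, hi⟩ := mem_iUnion.1 (hω 0).1
    exact (hω (i + 1)).2 (mem_biUnion (Finset.mem_coe.2 (Finset.self_mem_range_succ i)) hi)
  rw [he, measure_empty] at h
  obtain ⟨n, hn⟩ := (h.eventually (ge_mem_nhds (ENNReal.ofReal_pos.2 hη))).exists
  exact ⟨n, ENNReal.toReal_le_of_le_ofReal hη.le hn⟩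

namespace CoverableByLargeValues

lemma mono {E E' : Set X} {G G' : Set Ω} (h : CoverableByLargeValues P μ E G) (hE : E ⊆ E')
    (hG : G' ⊆ G) : CoverableByLargeValues P μ E' G' := by
  intro L η hL hη
  obtain ⟨m, A, hA, hle⟩ := h L η hL hη
  exact ⟨m, A, fun i => ⟨(hA i).1, (hA i).2.trans hE⟩,
    (measureReal_mono (sdiff_subset_sdiff_left hG)).trans hle⟩

omit [IsProbabilityMeasure P] in
lemma empty (E : Set X) : CoverableByLargeValues P μ E ∅ := by
  intro L η hL hη
  exact ⟨0, fun _ => ∅, fun _ => ⟨MeasurableSet.empty, empty_subset _⟩, by simpa using hη.le⟩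

/-- The level `L` in the definition is arbitrary, so the second family can be started at level `L *
2 ^ m` and appended after the `m` sets of the first. -/
lemma union {E : Set X} {G G' : Set Ω} (h : CoverableByLargeValues P μ E G)
    (h' : CoverableByLargeValues P μ E G') : CoverableByLargeValues P μ E (G ∪ G') := by
  intro L η hL hη
  obtain ⟨m, A, hA, hle⟩ := h L (η / 2) hL (half_pos hη)
  obtain ⟨m', A', hA', hle'⟩ := h' (L * 2 ^ m) (η / 2) (by positivity) (half_pos hη)
  refine ⟨m + m', fun i => if i < m then A i else A' (i - m), fun i => ?_, ?_⟩
  · dsimp only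
    split_ifs
    exacts [hA i, hA' _]
  · refine (measureReal_mono ?_).trans ((measureReal_union_le _ _).trans
      ((add_le_add hle hle').trans_eq (add_halves η)))
    rintro ω ⟨hω, hn⟩
    simp only [mem_iUnion, not_exists, Finset.mem_range, mem_ofPred_eq] at hn
    rcases hω with hω | hω
    · refine Or.inl ⟨hω, ?_⟩
      simp only [mem_iUnion, not_exists, Finset.mem_range, mem_ofPred_eq]
      intro i hi
      simpa [hi] using hn i (by omega)
    · refine Or.inr ⟨hω, ?_⟩
      simp only [mem_iUnion, not_exists, Finset.mem_range, mem_ofPred_eq]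
      intro i hi
      have := hn (m + i) (by omega)
      rwa [if_neg (by omega), Nat.add_sub_cancel_left, pow_add, ← mul_assoc] at this

lemma biUnion {ι : Type*} (s : Finset ι) {E : Set X} {G : ι → Set Ω}
    (h : ∀ i ∈ s, CoverableByLargeValues P μ E (G i)) :
    CoverableByLargeValues P μ E (⋃ i ∈ s, G i) := by
  classical
  induction s using Finset.induction_on with
  | empty => simpa using empty E
  | insert a s ha ih =>
    rw [Finset.set_biUnion_insert]
    exact (h a (by simp)).union (ih fun i hi => h i (by simp [hi]))

lemma of_approx {E : Set X} {G : Set Ω}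
    (h : ∀ η : ℝ, 0 < η → ∃ G', CoverableByLargeValues P μ E G' ∧ P.real (G \ G') ≤ η) :
    CoverableByLargeValues P μ E G := by
  intro L η hL hη
  obtain ⟨G', hG', hle⟩ := h (η / 2) (half_pos hη)
  obtain ⟨m, A, hA, hle'⟩ := hG' L (η / 2) hL (half_pos hη)
  refine ⟨m, A, hA, (measureReal_mono ?_).trans ((measureReal_union_le (G \ G') _).trans
    ((add_le_add hle hle').trans_eq (add_halves η)))⟩
  rintro ω ⟨hω, hn⟩
  by_cases hG : ω ∈ G'
  exacts [Or.inr ⟨hG, hn⟩, Or.inl ⟨hω, hG⟩]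

lemma iUnion {E : Set X} {G : ℕ → Set Ω} (hG : ∀ n, MeasurableSet (G n))
    (h : ∀ n, CoverableByLargeValues P μ E (G n)) :
    CoverableByLargeValues P μ E (⋃ n, G n) :=
  of_approx fun _ hη =>
    let ⟨m, hm⟩ := exists_measureReal_iUnion_diff_le hG hη
    ⟨_, biUnion (Finset.range m) fun i _ => h i, hm⟩

end CoverableByLargeValues

/-- Exhaustion: the probability space splits into a part that is covered by large values of `μ` on
subsets of `E` and a part where these values are bounded in probability. -/
lemma exists_coverable_bounded_compl (E : Set X) :
    ∃ B : Set Ω, MeasurableSet B ∧ CoverableByLargeValues P μ E B ∧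
      BoundedInProbabilityOn P μ E Bᶜ := by
  -- Coverable events are closed under countable unions, so the supremum of their probabilities is
  -- attained.
  let R : Set ℝ := P.real '' {B | MeasurableSet B ∧ CoverableByLargeValues P μ E B}
  have hRne : R.Nonempty := ⟨_, ∅, ⟨MeasurableSet.empty, CoverableByLargeValues.empty E⟩, rfl⟩
  have hRbdd : BddAbove R := ⟨1, by rintro _ ⟨B, -, rfl⟩; exact measureReal_le_one⟩
  have hex : ∀ n : ℕ, ∃ B, (MeasurableSet B ∧ CoverableByLargeValues P μ E B) ∧
      sSup R - 1 / ((n : ℝ) + 1) < P.real B := by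
    intro n
    obtain ⟨_, ⟨B, hB, rfl⟩, hlt⟩ := exists_lt_of_lt_csSup hRne
      (sub_lt_self (sSup R) (Nat.one_div_pos_of_nat (n := n)))
    exact ⟨B, hB, hlt⟩
  choose B hB hlt using hex
  have hBm : MeasurableSet (⋃ n, B n) := MeasurableSet.iUnion fun n => (hB n).1
  have hBc : CoverableByLargeValues P μ E (⋃ n, B n) :=
    CoverableByLargeValues.iUnion (fun n => (hB n).1) fun n => (hB n).2
  have hsup : sSup R ≤ P.real (⋃ n, B n) := by
    have h1 : ∀ n : ℕ, sSup R - 1 / ((n : ℝ) + 1) ≤ P.real (⋃ n, B n) := fun n =>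
      (hlt n).le.trans (measureReal_mono (subset_iUnion B n))
    have h2 := (tendsto_one_div_add_atTop_nhds_zero_nat (𝕜 := ℝ)).const_sub (sSup R)
    rw [sub_zero] at h2
    exact le_of_tendsto' h2 h1
  refine ⟨_, hBm, hBc, ?_⟩
  by_contra hcon
  unfold BoundedInProbabilityOn at hcon
  push Not at hcon
  obtain ⟨η, hη, hK⟩ := hcon
  choose A hAm hAE hA using fun n : ℕ => hK (4 ^ n)
  set C := (⋃ n, B n)ᶜ with hC
  let S : ℕ → Set Ω := fun i => {ω | (4 : ℝ) ^ i < |μ (A i) ω|}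
  have hS : ∀ i, MeasurableSet (S i) := fun i => measurableSet_lt_abs _ _
  -- If boundedness failed off the maximal event, the limsup of the events `S i` inside the
  -- complement would have probability at least `η`. It is coverable because the tail from `n` with
  -- `2 ^ n > L` satisfies `4 ^ (n + i) ≥ L * 2 ^ i`, which contradicts maximality.
  let U : ℕ → Set Ω := fun n => C ∩ ⋃ i, S (n + i)
  have hU : ∀ n, MeasurableSet (U n) := fun n =>
    hBm.compl.inter (MeasurableSet.iUnion fun i => hS _)
  have hUanti : Antitone U := antitone_nat_of_succ_le fun n =>
    inter_subset_inter_right _ (iUnion_subset fun i => by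
      rw [show n + 1 + i = n + (i + 1) by ring]
      exact subset_iUnion (fun i => S (n + i)) (i + 1))
  have hHη : η ≤ P.real (⋂ n, U n) := by
    have h := tendsto_measure_iInter_atTop (μ := P) (fun n => (hU n).nullMeasurableSet) hUanti
      ⟨0, measure_ne_top _ _⟩
    refine ge_of_tendsto' ((ENNReal.tendsto_toReal (measure_ne_top _ _)).comp h) fun n => ?_
    refine (hA n).le.trans (measureReal_mono (inter_subset_inter_right _ ?_))
    exact subset_iUnion (fun i => S (n + i)) 0
  have hHc : CoverableByLargeValues P μ E (⋂ n, U n) := by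
    intro L ε hL hε
    obtain ⟨n, hn⟩ := pow_unbounded_of_one_lt L (one_lt_two (α := ℝ))
    let T : ℕ → Set Ω := fun i => {ω | L * 2 ^ i < |μ (A (n + i)) ω|}
    obtain ⟨m, hm⟩ := exists_measureReal_iUnion_diff_le (P := P) (T := T)
      (fun i => measurableSet_lt_abs _ _) hε
    refine ⟨m, fun i => A (n + i), fun i => ⟨hAm _, hAE _⟩,
      (measureReal_mono (sdiff_subset_sdiff_left fun ω hω => ?_)).trans hm⟩
    obtain ⟨i, hi⟩ := mem_iUnion.1 (mem_iInter.1 hω n).2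
    refine mem_iUnion.2 ⟨i, ?_⟩
    simp only [S, T, mem_ofPred_eq] at hi ⊢
    refine lt_of_le_of_lt ?_ hi
    rw [pow_add]
    have h4 : ∀ k : ℕ, (2 : ℝ) ^ k ≤ 4 ^ k := fun k => by gcongr; norm_num
    exact mul_le_mul (hn.le.trans (h4 n)) (h4 i) (by positivity) (by positivity)
  have hHm : MeasurableSet (⋂ n, U n) := MeasurableSet.iInter hU
  have hdisj : Disjoint (⋃ n, B n) (⋂ n, U n) :=
    disjoint_left.2 fun ω h1 h2 => (mem_iInter.1 h2 0).1 h1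
  have hle := le_csSup hRbdd ⟨_, ⟨hBm.union hHm, hBc.union hHc⟩, rfl⟩
  rw [measureReal_union hdisj hHm] at hle
  linarith

end Coverable

/-! ### From a family of sets, through convex combinations, to a single set. -/

lemma exists_finset_disjoint_refinement {X : Type*} [MeasurableSpace X] (m : ℕ) {A : ℕ → Set X}
    (hA : ∀ i, MeasurableSet (A i)) :
    ∃ (s : Finset (Finset ℕ)) (B : Finset ℕ → Set X), (∀ S, MeasurableSet (B S)) ∧
      (s : Set (Finset ℕ)).PairwiseDisjoint B ∧ (∀ S ∈ s, ∃ i, B S ⊆ A i) ∧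
      ∀ i < m, ⋃ S ∈ s.filter (fun S => i ∈ S), B S = A i := by
  classical
  -- The atoms of the algebra generated by the first `m` sets. The atom of the empty index set,
  -- outside all `A i`, is discarded so that every kept atom lies in some `A i`.
  let B : Finset ℕ → Set X := fun S => ⋂ i ∈ Finset.range m, if i ∈ S then A i else (A i)ᶜ
  have hmem : ∀ S x, x ∈ B S ↔ ∀ i < m, (i ∈ S ↔ x ∈ A i) := by
    intro S x
    simp only [B, mem_iInter, Finset.mem_range]
    refine forall₂_congr fun i _ => ?_
    split_ifs with h <;> simp [h]
  refine ⟨(Finset.range m).powerset.filter Finset.Nonempty, B, fun S => ?_, ?_, ?_, ?_⟩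
  · refine Finset.measurableSet_biInter _ fun i _ => ?_
    split_ifs
    exacts [hA i, (hA i).compl]
  · intro S hS S' hS' hne
    refine disjoint_left.2 fun x hx hx' => hne ?_
    rw [hmem] at hx hx'
    simp only [Finset.coe_filter, Finset.mem_powerset, mem_ofPred_eq] at hS hS'
    ext i
    by_cases hi : i < m
    · rw [hx i hi, hx' i hi]
    · exact ⟨fun h => absurd (Finset.mem_range.1 (hS.1 h)) hi,
        fun h => absurd (Finset.mem_range.1 (hS'.1 h)) hi⟩
  · intro S hS
    rw [Finset.mem_filter, Finset.mem_powerset] at hS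
    obtain ⟨i, hi⟩ := hS.2
    exact ⟨i, fun x hx => ((hmem S x).1 hx i (Finset.mem_range.1 (hS.1 hi))).1 hi⟩
  · intro i hi
    ext x
    simp only [mem_iUnion, Finset.mem_filter, Finset.mem_powerset, exists_prop]
    constructor
    · rintro ⟨S, ⟨-, hiS⟩, hx⟩
      exact ((hmem S x).1 hx i hi).1 hiS
    · intro hx
      have h' : i ∈ (Finset.range m).filter (fun i => x ∈ A i) := by simp [hi, hx]
      refine ⟨(Finset.range m).filter (fun i => x ∈ A i),
        ⟨⟨Finset.filter_subset _ _, ⟨i, h'⟩⟩, h'⟩, (hmem _ _).2 fun j hj => ?_⟩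
      simp [hj]

section Rounding

variable {Ω : Type*} [MeasurableSpace Ω] {P : Measure Ω} [IsProbabilityMeasure P]
  {X : Type*} [MeasurableSpace X] {μ : Set X → (Ω →ₘ[P] ℝ)}

/-- Where a convex combination of values of `μ` is large, so is, with positive conditional
probability, a single value. -/
lemma IsStochasticMeasure.exists_large_of_convexCombination (hμ : IsStochasticMeasure P μ)
    {E : Set X} (m : ℕ) {A : ℕ → Set X} (hA : ∀ i, MeasurableSet (A i) ∧ A i ⊆ E) {b : ℕ → ℝ}
    (hb : ∀ i, 0 ≤ b i) (hb1 : ∑ i ∈ Finset.range m, b i ≤ 1) {L : ℝ} (hL : 0 ≤ L) {B : Set Ω}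
    (hB : MeasurableSet B) (hBL : ∀ ω ∈ B, L < |∑ i ∈ Finset.range m, b i * μ (A i) ω|) :
    ∃ D, MeasurableSet D ∧ D ⊆ E ∧ P.real B / 24 ≤ P.real (B ∩ {ω | L / 4 < |μ D ω|}) := by
  classical
  obtain ⟨s, C, hC, hdisj, hCA, hAC⟩ := exists_finset_disjoint_refinement m fun i => (hA i).1
  -- The coefficient of `μ (C S)` after the convex combination is expanded over atoms. It lies in
  -- `[0, 1]` and so serves as the probability of including the atom.
  let p : Finset ℕ → ℝ := fun S => ∑ i ∈ Finset.range m, if i ∈ S then b i else 0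
  have hp : ∀ S, 0 ≤ p S ∧ p S ≤ 1 := fun S =>
    ⟨Finset.sum_nonneg fun i _ => by split_ifs <;> simp [hb],
      (Finset.sum_le_sum fun i _ => by split_ifs <;> simp [hb]).trans hb1⟩
  have hhalf : ∀ S : Finset ℕ, (0 : ℝ) ≤ (fun _ => 1 / 2 : Finset ℕ → ℝ) S ∧
    (fun _ => 1 / 2 : Finset ℕ → ℝ) S ≤ 1 := by intro S; norm_num
  let D : Finset (Finset ℕ) → Set X := fun t => ⋃ S ∈ t, C S
  have hDm : ∀ t, MeasurableSet (D t) := fun t => t.measurableSet_biUnion fun S _ => hC S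
  have hDE : ∀ t ⊆ s, D t ⊆ E := fun t ht => iUnion₂_subset fun S hS => by
    obtain ⟨i, hi⟩ := hCA S (ht hS)
    exact hi.trans (hA i).2
  have hae := hμ.ae_apply_biUnion s (fun S _ => hC S) hdisj
  have key : 1 / 12 * P.real B ≤
      randomSubsetAvg (fun _ => 1 / 2) s (fun t => P.real (B ∩ {ω | L / 4 < |μ (D t) ω|})) +
      randomSubsetAvg p s (fun t => P.real (B ∩ {ω | L / 4 < |μ (D t) ω|})) := by
    have h := le_sum_mul_measureReal_inter (P := P) s.powerset (fun t =>
      (∏ S ∈ t, (1 / 2 : ℝ)) * ∏ S ∈ s \ t, (1 - 1 / 2 : ℝ) +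
        (∏ S ∈ t, p S) * ∏ S ∈ s \ t, (1 - p S)) (S := fun t => {ω | L / 4 < |μ (D t) ω|})
      (fun t _ => measurableSet_lt_abs _ _) hB (c := 1 / 12) ?_
    · simpa only [randomSubsetAvg, add_mul, Finset.sum_add_distrib] using h
    · filter_upwards [hae] with ω hω hωB
      have hmean : ∑ i ∈ Finset.range m, b i * μ (A i) ω = ∑ S ∈ s, p S * μ (C S) ω := by
        simp only [p, Finset.sum_mul]
        rw [Finset.sum_comm]
        refine Finset.sum_congr rfl fun i hi => ?_
        rw [← hAC i (Finset.mem_range.1 hi), hω _ (Finset.filter_subset _ _), Finset.mul_sum,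
          Finset.sum_filter]
        refine Finset.sum_congr rfl fun S _ => ?_
        split_ifs <;> simp
      have h1 := hBL ω hωB
      rw [hmean] at h1
      have h2 := randomSubsetAvg_rounding hp (fun S => μ (C S) ω) s hL h1
      simp only [add_mul, Finset.sum_add_distrib]
      refine h2.trans_eq ?_
      congr 1 <;>
      · refine Finset.sum_congr rfl fun t ht => ?_
        simp only [D, hω t (Finset.mem_powerset.1 ht)]
  have hor : P.real B / 24 ≤ randomSubsetAvg (fun _ => 1 / 2) s
        (fun t => P.real (B ∩ {ω | L / 4 < |μ (D t) ω|})) ∨ P.real B / 24 ≤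
      randomSubsetAvg p s (fun t => P.real (B ∩ {ω | L / 4 < |μ (D t) ω|})) := by
    by_contra! hcon
    linarith [hcon.1, hcon.2]
  rcases hor with h | h
  · obtain ⟨t, hts, ht⟩ := exists_le_of_le_randomSubsetAvg hhalf s h
    exact ⟨D t, hDm t, hDE t hts, ht⟩
  · obtain ⟨t, hts, ht⟩ := exists_le_of_le_randomSubsetAvg hp s h
    exact ⟨D t, hDm t, hDE t hts, ht⟩

/-- Coverability uses a different set for each `ω`; two randomizations produce one set that serves a
fixed fraction of `G`, however large `K` is. A random subset of the weighted values first gives a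
large convex combination, which is then rounded to a set. -/
lemma CoverableByLargeValues.exists_large (hμ : IsStochasticMeasure P μ) {E : Set X} {G : Set Ω}
    (hG : MeasurableSet G) (h : CoverableByLargeValues P μ E G) {K : ℝ} (hK : 0 ≤ K) :
    ∃ A, MeasurableSet A ∧ A ⊆ E ∧ P.real G / 100 ≤ P.real (G ∩ {ω | K < |μ A ω|}) := by
  classical
  rcases (measureReal_nonneg (μ := P) (s := G)).eq_or_lt with h0 | hpos
  · exact ⟨∅, MeasurableSet.empty, empty_subset _, by rw [← h0, zero_div]; exact measureReal_nonneg⟩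
  -- Each of the two randomizations costs a factor in the level, leaving `L / 16 = K + 1`. The
  -- probability drops by 1/2 for the covering, 1/2 for the random subset and 1/24 for the rounding:
  -- 1/96 in all.
  set L := 16 * (K + 1) with hL
  obtain ⟨m, A, hA, hle⟩ := h L (P.real G / 2) (by positivity) (half_pos hpos)
  set U := ⋃ i ∈ Finset.range m, {ω | L * 2 ^ i < |μ (A i) ω|} with hU
  have hUm : MeasurableSet U := Finset.measurableSet_biUnion _ fun i _ => measurableSet_lt_abs _ _
  have hGU : P.real G / 2 ≤ P.real (G ∩ U) := by
    have := measureReal_sdiff_add_inter (μ := P) (s := G) hUm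
    linarith
  -- These weights sum to at most 1, and `b i * (L * 2 ^ i) = L / 2` for every `i`: this is why the
  -- levels grow geometrically.
  let b : ℕ → ℝ := fun i => (1 / 2) ^ (i + 1)
  let S : Finset ℕ → Set Ω := fun t => {ω | L / 4 < |∑ i ∈ t, b i * μ (A i) ω|}
  have hS : ∀ t, MeasurableSet (S t) := fun t => measurableSet_lt measurable_const
    (Finset.measurable_fun_sum t fun i _ => (μ (A i)).measurable.const_mul _).abs
  have havg := le_randomSubsetAvg_measureReal (P := P) (fun _ => 1 / 2) (Finset.range m) (S := S)
    (fun t _ => hS t) (hG.inter hUm) (c := 1 / 2) ?_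
  swap
  · refine Eventually.of_forall fun ω hω => ?_
    obtain ⟨i, hi, hωi⟩ := mem_iUnion₂.1 hω.2
    simp only [mem_ofPred_eq] at hωi
    have hlarge : L / 2 < |b i * μ (A i) ω| := by
      rw [abs_mul, abs_of_nonneg (by positivity)]
      have e : L / 2 = b i * (L * 2 ^ i) := by
        simp only [b, pow_succ, one_div, inv_pow]
        field_simp
      rw [e]
      exact mul_lt_mul_of_pos_left hωi (by positivity)
    have hcard : 0 < ((Finset.range m).filter fun i => L / 2 < |b i * μ (A i) ω|).card :=
      Finset.card_pos.2 ⟨i, Finset.mem_filter.2 ⟨hi, hlarge⟩⟩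
    have h1 := randomSubsetAvg_small_le (q := 1 / 2) (by norm_num) le_rfl
      (fun i => b i * μ (A i) ω) (Finset.range m) (L / 2) 0
    rw [show (1 : ℝ) - 2 * (1 / 2) = 0 by norm_num, zero_pow hcard.ne', mul_zero, add_zero] at h1
    have h2 : randomSubsetAvg (fun _ => 1 / 2) (Finset.range m)
        (fun t => if ω ∈ S t then (1 : ℝ) else 0) =
        1 - randomSubsetAvg (fun _ => 1 / 2) (Finset.range m)
          (fun t => if |0 + ∑ i ∈ t, b i * μ (A i) ω| ≤ L / 2 / 2 then (1 : ℝ) else 0) := by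
      rw [eq_sub_iff_add_eq, ← randomSubsetAvg_add]
      refine (randomSubsetAvg_congr _ _ (ψ := fun _ => 1) fun t _ => ?_).trans
        (randomSubsetAvg_const _ _ _)
      simp only [S, mem_ofPred_eq, zero_add, show L / 2 / 2 = L / 4 by ring]
      split_ifs <;> linarith
    rw [h2]
    linarith
  obtain ⟨t, hts, ht⟩ := exists_le_of_le_randomSubsetAvg (by intro i; norm_num) _ havg
  have hsum : ∀ x : ℕ → ℝ, ∑ i ∈ Finset.range m, (if i ∈ t then b i else 0) * x i =
      ∑ i ∈ t, b i * x i := by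
    intro x
    simp only [ite_mul, zero_mul, ← Finset.sum_filter]
    congr 1
    ext i
    simpa using fun h => hts h
  have hb1 : ∑ i ∈ Finset.range m, (if i ∈ t then b i else 0) ≤ 1 := by
    calc _ ≤ ∑ i ∈ Finset.range m, b i := Finset.sum_le_sum fun i _ => by
          split_ifs <;> simp [b]
      _ = 1 / 2 * ∑ i ∈ Finset.range m, (1 / 2 : ℝ) ^ i := by
          rw [Finset.mul_sum]; exact Finset.sum_congr rfl fun i _ => by simp only [b]; ring
      _ ≤ 1 := by
          have := sum_geometric_two_le m
          linarith
  obtain ⟨D, hDm, hDE, hD⟩ := hμ.exists_large_of_convexCombination (P := P) (E := E) m hA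
    (b := fun i => if i ∈ t then b i else 0) (fun i => by split_ifs <;> simp [b])
    hb1 (L := L / 4) (by positivity) (B := G ∩ U ∩ S t) ((hG.inter hUm).inter (hS t))
    (fun ω hω => by rw [hsum]; exact hω.2)
  refine ⟨D, hDm, hDE, ?_⟩
  have h3 : P.real (G ∩ U ∩ S t ∩ {ω | L / 4 / 4 < |μ D ω|}) ≤
      P.real (G ∩ {ω | K < |μ D ω|}) := by
    refine measureReal_mono fun ω hω => ⟨hω.1.1.1, ?_⟩
    have := hω.2
    simp only [mem_ofPred_eq] at this ⊢
    linarith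
  linarith

end Rounding

/-! ### Partitions with many large parts. -/

section Boundedness

variable {Ω : Type*} [MeasurableSpace Ω] {P : Measure Ω} [IsProbabilityMeasure P]
  {X : Type*} [MeasurableSpace X] {μ : Set X → (Ω →ₘ[P] ℝ)}

lemma measureReal_le_of_ae_imp {s t : Set Ω} (h : ∀ᵐ ω ∂P, ω ∈ s → ω ∈ t) :
    P.real s ≤ P.real t :=
  ENNReal.toReal_mono (measure_ne_top _ _) (measure_mono_ae h)

/-- `μ E` is a single random variable, hence below some `K₀` up to small probability; where `|μ A|`
exceeds `K + K₀`, the complement must exceed `K` to compensate. -/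
lemma CoverableByLargeValues.exists_large_both (hμ : IsStochasticMeasure P μ) {E : Set X}
    (hE : MeasurableSet E) {G : Set Ω} (hG : MeasurableSet G)
    (h : CoverableByLargeValues P μ E G) {K : ℝ} (hK : 0 ≤ K) :
    ∃ A, MeasurableSet A ∧ A ⊆ E ∧
      P.real G / 200 ≤ P.real (G ∩ {ω | K < |μ A ω| ∧ K < |μ (E \ A) ω|}) := by
  rcases (measureReal_nonneg (μ := P) (s := G)).eq_or_lt with h0 | hpos
  · exact ⟨∅, MeasurableSet.empty, empty_subset _, by rw [← h0, zero_div]; exact measureReal_nonneg⟩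
  obtain ⟨K₀, hK₀, hle⟩ := exists_measureReal_lt_abs_le (μ E).aemeasurable
    (show 0 < P.real G / 200 by positivity)
  obtain ⟨A, hA, hAE, hlarge⟩ := h.exists_large hμ hG (add_nonneg hK hK₀)
  refine ⟨A, hA, hAE, ?_⟩
  have h1 : P.real (G ∩ {ω | K + K₀ < |μ A ω|}) ≤
      P.real (G ∩ {ω | K < |μ A ω| ∧ K < |μ (E \ A) ω|} ∪ {ω | K₀ < |μ E ω|}) := by
    refine measureReal_le_of_ae_imp ?_
    filter_upwards [hμ.ae_apply_inter_add_diff hE hA hAE] with ω hω hmem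
    obtain ⟨hωG, hω1⟩ := hmem
    simp only [mem_ofPred_eq, mem_union, mem_inter_iff] at hω1 ⊢
    by_cases hω2 : K₀ < |μ E ω|
    · exact Or.inr hω2
    · refine Or.inl ⟨hωG, by linarith, ?_⟩
      have := abs_sub (μ E ω) (μ (E \ A) ω)
      rw [show μ E ω - μ (E \ A) ω = μ A ω by rw [hω]; ring] at this
      linarith
  linarith [h1.trans (measureReal_union_le _ _)]

/-- A set that is large on 1/100 of `R` is cut into two pieces, each large on at most 1/400 of `R`.
So when a part is split, almost every `ω` stays coverable over one of the halves. -/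
lemma CoverableByLargeValues.measureReal_eq_zero (hμ : IsStochasticMeasure P μ) {E₁ E₂ : Set X}
    (h₁ : MeasurableSet E₁) (h₂ : MeasurableSet E₂) (hd : Disjoint E₁ E₂) {R : Set Ω}
    (hR : MeasurableSet R) (h : CoverableByLargeValues P μ (E₁ ∪ E₂) R)
    (hb₁ : BoundedInProbabilityOn P μ E₁ R) (hb₂ : BoundedInProbabilityOn P μ E₂ R) :
    P.real R = 0 := by
  by_contra hne
  have hpos : 0 < P.real R := lt_of_le_of_ne measureReal_nonneg (Ne.symm hne)
  obtain ⟨K₁, hK₁⟩ := hb₁ (P.real R / 400) (by positivity)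
  obtain ⟨K₂, hK₂⟩ := hb₂ (P.real R / 400) (by positivity)
  obtain ⟨A, hA, hAE, hlarge⟩ := h.exists_large hμ hR (K := |K₁| + |K₂|) (by positivity)
  have hAU : A = A ∩ E₁ ∪ A ∩ E₂ := by rw [← inter_union_distrib_left, inter_eq_left.2 hAE]
  have hadd := hμ.apply_union (hA.inter h₁) (hA.inter h₂)
    (hd.mono inter_subset_right inter_subset_right)
  rw [← hAU] at hadd
  have h3 : P.real (R ∩ {ω | |K₁| + |K₂| < |μ A ω|}) ≤
      P.real (R ∩ {ω | K₁ < |μ (A ∩ E₁) ω|} ∪ R ∩ {ω | K₂ < |μ (A ∩ E₂) ω|}) := by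
    refine measureReal_le_of_ae_imp ?_
    filter_upwards [AEEqFun.coeFn_add (μ (A ∩ E₁)) (μ (A ∩ E₂))] with ω hω hmem
    obtain ⟨hωR, hω1⟩ := hmem
    simp only [mem_ofPred_eq, mem_union, mem_inter_iff] at hω1 ⊢
    rw [hadd, hω, Pi.add_apply] at hω1
    by_contra! hcon
    have := abs_add_le (μ (A ∩ E₁) ω) (μ (A ∩ E₂) ω)
    linarith [hcon.1 hωR, hcon.2 hωR, le_abs_self K₁, le_abs_self K₂]
  have h4 := hK₁ _ (hA.inter h₁) inter_subset_right
  have h5 := hK₂ _ (hA.inter h₂) inter_subset_right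
  linarith [h3.trans (measureReal_union_le _ _)]

lemma BoundedInProbabilityOn.mono {E : Set X} {G G' : Set Ω}
    (h : BoundedInProbabilityOn P μ E G) (hG : G' ⊆ G) : BoundedInProbabilityOn P μ E G' := by
  intro η hη
  obtain ⟨K, hK⟩ := h η hη
  exact ⟨K, fun A hA hAE =>
    (measureReal_mono (inter_subset_inter_left _ hG)).trans (hK A hA hAE)⟩

open Classical in
/-- A finite partition for which, on average, the number of parts with a large value is at least
proportional to `n`; each `ω` still has a part over which `μ` is unbounded. -/
lemma CoverableByLargeValues.exists_partition_many_large (hμ : IsStochasticMeasure P μ)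
    {E : Set X} (hE : MeasurableSet E) {G : Set Ω} (hG : MeasurableSet G)
    (h : CoverableByLargeValues P μ E G) (n : ℕ) : ∀ K : ℝ, 0 ≤ K →
    ∃ (ι : Type) (_ : Fintype ι) (D : ι → Set X) (H : ι → Set Ω) (S : ℕ → Set Ω),
      (∀ k, MeasurableSet (D k) ∧ D k ⊆ E) ∧ (Pairwise fun k l => Disjoint (D k) (D l)) ∧
      (∀ k, MeasurableSet (H k) ∧ H k ⊆ G ∧ CoverableByLargeValues P μ (D k) (H k)) ∧
      (Pairwise fun k l => Disjoint (H k) (H l)) ∧ P.real (⋃ k, H k) = P.real G ∧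
      (∀ j < n, MeasurableSet (S j) ∧ S j ⊆ G ∧ P.real G / 200 ≤ P.real (S j)) ∧
      ∀ᵐ ω ∂P, ∑ j ∈ Finset.range n, (if ω ∈ S j then 1 else 0) ≤
        (Finset.univ.filter fun k => K < |μ (D k) ω|).card := by
  induction n with
  | zero =>
    intro K hK
    refine ⟨Unit, inferInstance, fun _ => E, fun _ => G, fun _ => ∅, fun _ => ⟨hE, subset_rfl⟩,
      fun k l hkl => absurd rfl hkl, fun _ => ⟨hG, subset_rfl, h⟩, fun k l hkl => absurd rfl hkl,
      by rw [iUnion_const], fun j hj => absurd hj (Nat.not_lt_zero j), by simp⟩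
  | succ n ih =>
    intro K hK
    -- The previous threshold is doubled: a part with value above `2 * K` keeps a half above `K`, so
    -- splitting every part never lowers the count.
    obtain ⟨ι, _, D, H, S, hD, hDd, hH, hHd, hHG, hS, hcount⟩ := ih (2 * K) (by positivity)
    choose A hAm hAD hA using fun k => (hH k).2.2.exists_large_both hμ (hD k).1 (hH k).1 hK
    choose B hBm hBc hBb using fun k =>
      exists_coverable_bounded_compl (P := P) (μ := μ) (A k)
    choose B' hBm' hBc' hBb' using fun k =>
      exists_coverable_bounded_compl (P := P) (μ := μ) (D k \ A k)
    let T : ι → Set Ω := fun k => H k ∩ {ω | K < |μ (A k) ω| ∧ K < |μ (D k \ A k) ω|}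
    have hT : ∀ k, MeasurableSet (T k) := fun k => (hH k).1.inter
      ((measurableSet_lt_abs _ _).inter (measurableSet_lt_abs _ _))
    let D' : ι × Bool → Set X := fun k => if k.2 then A k.1 else D k.1 \ A k.1
    -- Points coverable over `A k` go to `A k`, and only the remaining ones to `D k \ A k`, which
    -- keeps the events disjoint.
    let H' : ι × Bool → Set Ω := fun k =>
      if k.2 then H k.1 ∩ B k.1 else (H k.1 ∩ B' k.1) \ B k.1
    have hD' : ∀ k, D' k ⊆ D k.1 := by
      rintro ⟨k, b⟩; cases b
      exacts [sdiff_subset, hAD k]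
    have hH' : ∀ k, H' k ⊆ H k.1 := by
      rintro ⟨k, b⟩; cases b
      exacts [sdiff_subset.trans inter_subset_left, inter_subset_left]
    refine ⟨ι × Bool, inferInstance, D', H', fun j => if j < n then S j else ⋃ k, T k,
      ?_, ?_, ?_, ?_, ?_, ?_, ?_⟩
    · intro k
      refine ⟨?_, (hD' k).trans (hD k.1).2⟩
      obtain ⟨k, b⟩ := k; cases b
      exacts [(hD k).1.diff (hAm k), hAm k]
    · rintro ⟨k, b⟩ ⟨l, c⟩ hne
      by_cases hkl : k = l
      · subst hkl
        cases b <;> cases c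
        · exact absurd rfl hne
        · exact disjoint_sdiff_left
        · exact disjoint_sdiff_right
        · exact absurd rfl hne
      · exact (hDd hkl).mono (hD' _) (hD' _)
    · rintro ⟨k, b⟩
      refine ⟨?_, (hH' _).trans (hH k).2.1, ?_⟩ <;> cases b
      · exact ((hH k).1.inter (hBm' k)).diff (hBm k)
      · exact (hH k).1.inter (hBm k)
      · exact (hBc' k).mono subset_rfl (sdiff_subset.trans inter_subset_right)
      · exact (hBc k).mono subset_rfl inter_subset_right
    · rintro ⟨k, b⟩ ⟨l, c⟩ hne
      by_cases hkl : k = l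
      · subst hkl
        cases b <;> cases c
        · exact absurd rfl hne
        · exact disjoint_sdiff_left.mono_right inter_subset_right
        · exact disjoint_sdiff_right.mono_left inter_subset_right
        · exact absurd rfl hne
      · exact (hHd hkl).mono (hH' _) (hH' _)
    · refine le_antisymm (measureReal_mono (iUnion_subset fun k =>
        (hH' k).trans (hH k.1).2.1)) ?_
      have hnull : ∀ k, P.real (H k \ (B k ∪ B' k)) = 0 := fun k => by
        have hU : A k ∪ D k \ A k = D k := union_sdiff_cancel (hAD k)
        refine CoverableByLargeValues.measureReal_eq_zero hμ (hAm k) ((hD k).1.diff (hAm k))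
          disjoint_sdiff_right ((hH k).1.diff ((hBm k).union (hBm' k)))
          (hU.symm ▸ (hH k).2.2.mono subset_rfl sdiff_subset)
          ((hBb k).mono fun ω hω => fun h' => hω.2 (Or.inl h'))
          ((hBb' k).mono fun ω hω => fun h' => hω.2 (Or.inr h'))
      rw [← hHG]
      have hsub : (⋃ k, H k) ⊆ (⋃ k, H' k) ∪ ⋃ k, H k \ (B k ∪ B' k) := by
        intro ω hω
        obtain ⟨k, hk⟩ := mem_iUnion.1 hω
        by_cases h1 : ω ∈ B k
        · exact Or.inl (mem_iUnion.2 ⟨(k, true), hk, h1⟩)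
        · by_cases h2 : ω ∈ B' k
          · exact Or.inl (mem_iUnion.2 ⟨(k, false), ⟨hk, h2⟩, h1⟩)
          · exact Or.inr (mem_iUnion.2 ⟨k, hk, fun h' => h'.elim h1 h2⟩)
      have hnull' : P.real (⋃ k, H k \ (B k ∪ B' k)) = 0 := by
        rw [measureReal_eq_zero_iff, measure_iUnion_null_iff]
        exact fun k => (measureReal_eq_zero_iff).1 (hnull k)
      linarith [(measureReal_mono hsub).trans (measureReal_union_le (μ := P) _ _)]
    · intro j hj
      by_cases hjn : j < n
      · simpa only [if_pos hjn] using hS j hjn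
      · simp only [if_neg hjn]
        refine ⟨MeasurableSet.iUnion hT, iUnion_subset fun k =>
          inter_subset_left.trans (hH k).2.1, ?_⟩
        have hTd : Pairwise fun k l => Disjoint (T k) (T l) := fun k l hkl =>
          (hHd hkl).mono inter_subset_left inter_subset_left
        rw [← hHG, measureReal_iUnion_fintype hHd (fun k => (hH k).1),
          measureReal_iUnion_fintype hTd hT, Finset.sum_div]
        exact Finset.sum_le_sum fun k _ => hA k
    · have hsplit : ∀ᵐ ω ∂P, ∀ k, μ (D k) ω = μ (A k) ω + μ (D k \ A k) ω :=
        ae_all_iff.2 fun k => hμ.ae_apply_inter_add_diff (hD k).1 (hAm k) (hAD k)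
      filter_upwards [hcount, hsplit] with ω hω hsp
      rw [Finset.sum_range_succ, Finset.card_filter, Fintype.sum_prod_type]
      rw [Finset.card_filter] at hω
      have hlast : (∑ k, if 2 * K < |μ (D k) ω| then 1 else 0) +
          (if ω ∈ ⋃ k, T k then 1 else 0) ≤
          ∑ k, ∑ b : Bool, if K < |μ (D' (k, b)) ω| then 1 else 0 := by
        have hterm : ∀ k, (if 2 * K < |μ (D k) ω| then 1 else 0) ≤
            ∑ b : Bool, if K < |μ (D' (k, b)) ω| then 1 else 0 := by
          intro k
          simp only [Fintype.sum_bool, D', if_true, Bool.false_eq_true, if_false]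
          by_cases h2 : 2 * K < |μ (D k) ω|
          · rw [if_pos h2]
            by_contra! hcon
            have h3 : ¬ K < |μ (A k) ω| := fun h' => by simp [h'] at hcon
            have h4 : ¬ K < |μ (D k \ A k) ω| := fun h' => by simp [h'] at hcon
            have := abs_add_le (μ (A k) ω) (μ (D k \ A k) ω)
            rw [hsp k] at h2
            linarith
          · rw [if_neg h2]; exact Nat.zero_le _
        -- On `T k₀` both halves of part `k₀` exceed `K`: it now counts 2 and counted at most 1
        -- before, so the total gains one.
        by_cases hU : ω ∈ ⋃ k, T k
        · rw [if_pos hU]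
          obtain ⟨k₀, hk₀⟩ := mem_iUnion.1 hU
          have h1 : ∑ k, ((if 2 * K < |μ (D k) ω| then 1 else 0) + if k = k₀ then 1 else 0) ≤
              ∑ k, ∑ b : Bool, if K < |μ (D' (k, b)) ω| then 1 else 0 := by
            refine Finset.sum_le_sum fun k _ => ?_
            by_cases hk : k = k₀
            · subst hk
              simp only [Fintype.sum_bool, D', if_true, Bool.false_eq_true, if_false,
                if_pos hk₀.2.1, if_pos hk₀.2.2]
              split_ifs <;> omega
            · simpa [hk] using hterm k
          rw [Finset.sum_add_distrib, Finset.sum_ite_eq'] at h1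
          simpa using h1
        · rw [if_neg hU, add_zero]
          exact Finset.sum_le_sum fun k _ => hterm k
      have hfirst : ∑ j ∈ Finset.range n,
          (if ω ∈ (if j < n then S j else ⋃ k, T k) then 1 else 0) =
          ∑ j ∈ Finset.range n, if ω ∈ S j then 1 else 0 :=
        Finset.sum_congr rfl fun j hj => by rw [if_pos (Finset.mem_range.1 hj)]
      have hl : (if ω ∈ (if n < n then S n else ⋃ k, T k) then 1 else 0) =
          if ω ∈ ⋃ k, T k then 1 else 0 := by simp only [lt_irrefl, if_false]
      rw [hfirst, hl]
      omega

-- Reverse Markov inequality: on `G` the number of occurring events is at most `c * n + n * 1_W`,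
-- while its integral is at least `2 * c * n * P(G)`.
open Classical in
lemma measureReal_frequent_ge {G : Set Ω} (hG : MeasurableSet G) {n : ℕ} (hn : 0 < n)
    {S : ℕ → Set Ω} {c : ℝ}
    (hS : ∀ j < n, MeasurableSet (S j) ∧ S j ⊆ G ∧ 2 * c * P.real G ≤ P.real (S j)) (hc : 0 ≤ c) :
    ∃ W ⊆ G, MeasurableSet W ∧ c * P.real G ≤ P.real W ∧
      ∀ ω ∈ W, c * n ≤ ∑ j ∈ Finset.range n, if ω ∈ S j then 1 else 0 := by
  let N : Ω → ℝ := fun ω => ∑ j ∈ Finset.range n, if ω ∈ S j then 1 else 0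
  have hN : Measurable N := Finset.measurable_fun_sum _ fun j hj =>
    Measurable.ite (hS j (Finset.mem_range.1 hj)).1 measurable_const measurable_const
  have hWm : MeasurableSet (G ∩ {ω | c * n ≤ N ω}) := hG.inter (measurableSet_le measurable_const hN)
  refine ⟨G ∩ {ω | c * n ≤ N ω}, inter_subset_left, hWm, ?_, fun ω hω => hω.2⟩
  set W := G ∩ {ω | c * n ≤ N ω}
  -- The events `S j` enter with weight `-1` and `W`, stored at index `n`, with weight `n`.
  have h := le_sum_mul_measureReal_inter (P := P) (Finset.range (n + 1))
    (fun j => if j < n then -1 else (n : ℝ)) (S := fun j => if j < n then S j else W)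
    (fun j _ => by
      by_cases hj : j < n
      · simpa only [if_pos hj] using (hS j hj).1
      · simpa only [if_neg hj] using hWm) hG (c := - (c * n)) ?_
  · rw [Finset.sum_range_succ, if_neg (lt_irrefl n), if_neg (lt_irrefl n),
      inter_eq_right.2 (show W ⊆ G from inter_subset_left)] at h
    have h1 : ∑ j ∈ Finset.range n, (if j < n then -1 else (n : ℝ)) *
        P.real (G ∩ if j < n then S j else W) ≤ ∑ j ∈ Finset.range n, - (2 * c * P.real G) := by
      refine Finset.sum_le_sum fun j hj => ?_
      have hj := Finset.mem_range.1 hj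
      rw [if_pos hj, if_pos hj, inter_eq_right.2 (hS j hj).2.1]
      linarith [(hS j hj).2.2]
    rw [Finset.sum_const, Finset.card_range, nsmul_eq_mul] at h1
    have hn' : (0 : ℝ) < n := Nat.cast_pos.2 hn
    refine le_of_mul_le_mul_left ?_ hn'
    linarith
  · refine Eventually.of_forall fun ω hω => ?_
    rw [Finset.sum_range_succ, if_neg (lt_irrefl n), if_neg (lt_irrefl n)]
    have h1 : ∑ j ∈ Finset.range n, (if j < n then -1 else (n : ℝ)) *
        (if ω ∈ (if j < n then S j else W) then 1 else 0) = - N ω := by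
      simp only [N, ← Finset.sum_neg_distrib]
      refine Finset.sum_congr rfl fun j hj => ?_
      rw [if_pos (Finset.mem_range.1 hj), if_pos (Finset.mem_range.1 hj)]
      ring
    rw [h1]
    have hNn : N ω ≤ n := by
      calc N ω ≤ ∑ j ∈ Finset.range n, (1 : ℝ) := Finset.sum_le_sum fun j _ => by
            split_ifs <;> norm_num
        _ = n := by simp
    by_cases hW : ω ∈ W
    · rw [if_pos hW]
      have : 0 ≤ c * n := by positivity
      linarith
    · rw [if_neg hW]
      have : ¬ c * n ≤ N ω := fun h' => hW ⟨hω, h'⟩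
      linarith

lemma randomSubsetAvg_sum {ι : Type*} [DecidableEq ι] (p x : ι → ℝ) (s : Finset ι) :
    randomSubsetAvg p s (fun t => ∑ i ∈ t, x i) = ∑ i ∈ s, p i * x i := by
  induction s using Finset.induction_on with
  | empty => simp [randomSubsetAvg_empty]
  | insert a s ha ih =>
    rw [randomSubsetAvg_sum_insert p x ha (fun y => y), randomSubsetAvg_add,
      randomSubsetAvg_const, ih, Finset.sum_insert ha]
    ring

end Boundedness

/-! ### Boundedness in probability of the range and of sums of squares. -/

section Boundedness

variable {Ω : Type*} [MeasurableSpace Ω] {P : Measure Ω} [IsProbabilityMeasure P]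
  {X : Type*} [MeasurableSpace X] {μ : Set X → (Ω →ₘ[P] ℝ)}

/-- One can remove from `E` a set on which `μ` is large with probability comparable to that of
`G`, such that `μ` remains unbounded over the rest of `E` on almost all of `G`. -/
lemma CoverableByLargeValues.exists_remove (hμ : IsStochasticMeasure P μ)
    {E : Set X} (hE : MeasurableSet E) {G : Set Ω} (hG : MeasurableSet G)
    (h : CoverableByLargeValues P μ E G) {η : ℝ} (hη : 0 < η) (hη1 : η ≤ 1) :
    ∃ (D : Set X) (G' : Set Ω), MeasurableSet D ∧ D ⊆ E ∧ MeasurableSet G' ∧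
      CoverableByLargeValues P μ (E \ D) G' ∧ (1 - η) * P.real G ≤ P.real G' ∧
      P.real G / 3200 ≤ P.real {ω | 1 < |μ D ω|} := by
  classical
  -- Sparse inclusion probability: the expected loss `q * P(G)`, penalized by `1 / η`, is `P(G) /
  -- 3200`, half of the gain `1/4 * P(G) / 400`.
  set q : ℝ := η / 3200 with hq
  have hq0 : 0 < q := by positivity
  have hq1 : q ≤ 1 / 2 := by rw [hq]; linarith
  have hqp : ∀ {ι : Type} (k : ι), 0 ≤ (fun _ => q : ι → ℝ) k ∧ (fun _ => q : ι → ℝ) k ≤ 1 :=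
    fun k => ⟨hq0.le, by dsimp only; linarith⟩
  -- With `N` large parts, anti-concentration bounds the chance of a small union by `1/2 + 1/4`,
  -- leaving 1/4 even though `q` is tiny.
  obtain ⟨N, hN⟩ := exists_pow_lt_of_lt_one (show (0 : ℝ) < 1 / 2 by norm_num)
    (show 1 - 2 * q < 1 by linarith)
  obtain ⟨ι, _, D, H, S, hD, hDd, hH, hHd, hHG, hS, hcount⟩ :=
    h.exists_partition_many_large hμ hE hG (400 * (N + 1)) 2 (by norm_num)
  obtain ⟨W, hWG, hWm, hWP, hW⟩ := measureReal_frequent_ge (P := P) hG (n := 400 * (N + 1))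
    (by positivity) (S := S) (c := 1 / 400)
    (fun j hj => ⟨(hS j hj).1, (hS j hj).2.1, by linarith [(hS j hj).2.2]⟩) (by norm_num)
  have hDU := hμ.ae_apply_biUnion (Finset.univ : Finset ι) (fun k _ => (hD k).1)
    (fun k _ l _ hkl => hDd hkl)
  let U : Finset ι → Set X := fun t => ⋃ k ∈ t, D k
  have havg := le_randomSubsetAvg_measureReal (P := P) (fun _ => q) (Finset.univ : Finset ι)
    (S := fun t => {ω | 1 < |μ (U t) ω|}) (fun t _ => measurableSet_lt_abs _ _) hWm (c := 1 / 4) ?_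
  swap
  · filter_upwards [hcount, hDU] with ω hω hadd hωW
    have h1 := hW ω hωW
    have hc : N ≤ (Finset.univ.filter fun k => 2 < |μ (D k) ω|).card := by
      have h2 : (∑ j ∈ Finset.range (400 * (N + 1)), if ω ∈ S j then (1 : ℝ) else 0) ≤
          ((Finset.univ.filter fun k => 2 < |μ (D k) ω|).card : ℝ) := by
        have := (Nat.cast_le (α := ℝ)).2 hω
        push_cast at this
        exact this
      have h3 := h1.trans h2
      push_cast at h3
      have h4 : (N : ℝ) ≤ ((Finset.univ.filter fun k => 2 < |μ (D k) ω|).card : ℝ) := by linarith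
      exact_mod_cast h4
    have h2 := randomSubsetAvg_small_le hq0.le hq1 (fun k => μ (D k) ω) Finset.univ 2 0
    have h3 : (1 - 2 * q) ^ (Finset.univ.filter fun k => 2 < |μ (D k) ω|).card ≤ 1 / 2 :=
      (pow_le_pow_of_le_one (by linarith) (by linarith) hc).trans hN.le
    have h4 : randomSubsetAvg (fun _ => q) Finset.univ
        (fun t => if 1 < |μ (U t) ω| then (1 : ℝ) else 0) =
        1 - randomSubsetAvg (fun _ => q) Finset.univ
          (fun t => if |0 + ∑ k ∈ t, μ (D k) ω| ≤ 2 / 2 then (1 : ℝ) else 0) := by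
      rw [eq_sub_iff_add_eq, ← randomSubsetAvg_add]
      refine (randomSubsetAvg_congr _ _ (ψ := fun _ => 1) fun t ht => ?_).trans
        (randomSubsetAvg_const _ _ _)
      simp only [U, zero_add, hadd t ht, div_self (two_ne_zero' ℝ)]
      split_ifs <;> linarith
    refine le_trans ?_ h4.ge
    linarith
  have hsumH : ∑ k, P.real (H k) = P.real G := by
    rw [← hHG, measureReal_iUnion_fintype hHd (fun k => (hH k).1)]
  -- Gain and penalized loss are averaged together, so that one `t` controls both.
  have havg2 : P.real G / 3200 ≤ randomSubsetAvg (fun _ => q) Finset.univ (fun t =>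
      P.real (W ∩ {ω | 1 < |μ (U t) ω|}) - 1 / η * ∑ k ∈ t, P.real (H k)) := by
    rw [randomSubsetAvg_sub, randomSubsetAvg_mul, randomSubsetAvg_sum, ← Finset.mul_sum, hsumH]
    have : 1 / η * (q * P.real G) = P.real G / 3200 := by rw [hq]; field_simp
    linarith
  obtain ⟨t, -, ht⟩ := exists_le_of_le_randomSubsetAvg hqp _ havg2
  have hHt : 0 ≤ ∑ k ∈ t, P.real (H k) := Finset.sum_nonneg fun k _ => measureReal_nonneg
  have hWt : P.real (W ∩ {ω | 1 < |μ (U t) ω|}) ≤ P.real G :=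
    measureReal_mono (inter_subset_left.trans hWG)
  have hlarge : P.real (W ∩ {ω | 1 < |μ (U t) ω|}) ≤ P.real {ω | 1 < |μ (U t) ω|} :=
    measureReal_mono inter_subset_right
  have hpos : 0 ≤ 1 / η * ∑ k ∈ t, P.real (H k) := by positivity
  refine ⟨U t, ⋃ k ∈ tᶜ, H k, t.measurableSet_biUnion fun k _ => (hD k).1,
    iUnion₂_subset fun k _ => (hD k).2, Finset.measurableSet_biUnion _ fun k _ => (hH k).1,
    CoverableByLargeValues.biUnion _ fun k hk => (hH k).2.2.mono ?_ subset_rfl, ?_, by linarith⟩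
  · refine subset_sdiff.2 ⟨(hD k).2, disjoint_iUnion₂_right.2 fun l hl => hDd ?_⟩
    rintro rfl
    exact Finset.mem_compl.1 hk hl
  · rw [measureReal_biUnion_finset (fun k _ l _ hkl => hHd hkl) (fun k _ => (hH k).1)]
    have h5 := Finset.sum_add_sum_compl t fun k => P.real (H k)
    have h6 : ∑ k ∈ t, P.real (H k) ≤ η * P.real G := by
      have h7 : 1 / η * ∑ k ∈ t, P.real (H k) ≤ P.real G := by
        have : 0 ≤ P.real G := measureReal_nonneg
        linarith
      rwa [one_div_mul_eq_div, div_le_iff₀ hη, mul_comm] at h7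
    linarith

/-- The range of a stochastic measure is bounded in probability. -/
theorem IsStochasticMeasure.boundedInProbability (hμ : IsStochasticMeasure P μ) :
    BoundedInProbabilityOn P μ univ univ := by
  obtain ⟨B, hBm, hBc, hBb⟩ := exists_coverable_bounded_compl (P := P) (μ := μ) univ
  suffices h0 : P.real B = 0 by
    intro η hη
    obtain ⟨K, hK⟩ := hBb η hη
    refine ⟨K, fun A hA hAE => ?_⟩
    have h1 : P.real (univ ∩ {ω | K < |μ A ω|}) ≤ P.real (B ∪ Bᶜ ∩ {ω | K < |μ A ω|}) :=
      measureReal_mono fun ω hω => by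
        by_cases hωB : ω ∈ B
        exacts [Or.inl hωB, Or.inr ⟨hωB, hω.2⟩]
    linarith [h1.trans (measureReal_union_le _ _), hK A hA hAE]
  by_contra hne
  have hβ : 0 < P.real B := lt_of_le_of_ne measureReal_nonneg (Ne.symm hne)
  -- The hypotheses are placed inside the existential so that `choose` gives total functions for the
  -- recursion; the empty sets are default values.
  have hrem : ∀ (p : Set X × Set Ω) (n : ℕ), ∃ (D : Set X) (G' : Set Ω),
      MeasurableSet p.1 ∧ MeasurableSet p.2 ∧ CoverableByLargeValues P μ p.1 p.2 →
      MeasurableSet D ∧ D ⊆ p.1 ∧ MeasurableSet G' ∧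
      CoverableByLargeValues P μ (p.1 \ D) G' ∧
      (1 - (1 / 2) ^ (n + 2)) * P.real p.2 ≤ P.real G' ∧
      P.real p.2 / 3200 ≤ P.real {ω | 1 < |μ D ω|} := by
    intro p n
    by_cases hp : MeasurableSet p.1 ∧ MeasurableSet p.2 ∧ CoverableByLargeValues P μ p.1 p.2
    · obtain ⟨D, G', h⟩ := hp.2.2.exists_remove hμ hp.1 hp.2.1
        (η := (1 / 2) ^ (n + 2)) (by positivity) (pow_le_one₀ (by norm_num) (by norm_num))
      exact ⟨D, G', fun _ => h⟩
    · exact ⟨∅, ∅, fun h => absurd h hp⟩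
  choose D G' hDG using hrem
  let st : ℕ → Set X × Set Ω := fun n =>
    Nat.rec (univ, B) (fun n p => (p.1 \ D p n, G' p n)) n
  -- The losses `2 ^ -(n + 2)` are summable: `1/2 + 2 ^ -(n + 1)` equals 1 at `n = 0`, survives each
  -- step, and keeps at least half of `P(B)`.
  have hst : ∀ n, (MeasurableSet (st n).1 ∧ MeasurableSet (st n).2 ∧
      CoverableByLargeValues P μ (st n).1 (st n).2) ∧
      (1 / 2 + (1 / 2) ^ (n + 1)) * P.real B ≤ P.real (st n).2 := by
    intro n
    induction n with
    | zero => exact ⟨⟨MeasurableSet.univ, hBm, hBc⟩, by norm_num [st]⟩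
    | succ n ih =>
      obtain ⟨h1, h2, h3, h4, h5, -⟩ := hDG (st n) n ih.1
      refine ⟨⟨ih.1.1.diff h1, h3, h4⟩, ?_⟩
      refine le_trans ?_ h5
      refine le_trans ?_ (mul_le_mul_of_nonneg_left ih.2 ?_)
      · rw [← mul_assoc]
        refine mul_le_mul_of_nonneg_right ?_ hβ.le
        have hx : (1 / 2 : ℝ) ^ n ≤ 1 := pow_le_one₀ (by norm_num) (by norm_num)
        have hx0 : (0 : ℝ) < (1 / 2) ^ n := by positivity
        simp only [pow_succ]
        nlinarith
      · have : (1 / 2 : ℝ) ^ (n + 2) ≤ 1 := pow_le_one₀ (by norm_num) (by norm_num)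
        linarith
  have hanti : Antitone fun n => (st n).1 := antitone_nat_of_succ_le fun n => sdiff_subset
  let A : ℕ → Set X := fun n => D (st n) n
  have hAdisj : Pairwise fun i j => Disjoint (A i) (A j) := by
    have hlt : ∀ i j, i < j → Disjoint (A i) (A j) := fun i j hij => by
      have h1 : A j ⊆ (st (i + 1)).1 := (hDG (st j) j (hst j).1).2.1.trans (hanti hij)
      exact (disjoint_sdiff_left.mono_left h1).symm
    intro i j hij
    rcases lt_or_gt_of_ne hij with h | h
    exacts [hlt i j h, (hlt j i h).symm]
  have hlim := hμ.tendsto_disjoint (fun n => (hDG (st n) n (hst n).1).1) hAdisj one_pos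
  have hge : ∀ n, P.real B / 6400 ≤ P.real {ω | 1 < |μ (A n) ω|} := by
    intro n
    have h1 := (hDG (st n) n (hst n).1).2.2.2.2.2
    have h2 := (hst n).2
    have hx0 : (0 : ℝ) < (1 / 2) ^ (n + 1) * P.real B := by positivity
    linarith
  linarith [ge_of_tendsto' hlim hge]

/-- Sums of squares of a stochastic measure over finite disjoint families are bounded in
probability. -/
theorem IsStochasticMeasure.sum_sq_boundedInProbability (hμ : IsStochasticMeasure P μ) {η : ℝ}
    (hη : 0 < η) :
    ∃ K : ℝ, ∀ (s : Finset ℕ) (A : ℕ → Set X), (∀ i ∈ s, MeasurableSet (A i)) →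
      (s : Set ℕ).PairwiseDisjoint A → P.real {ω | K < ∑ i ∈ s, μ (A i) ω ^ 2} ≤ η := by
  classical
  -- Paley–Zygmund loses the factor 12 in probability. The variance is a quarter of the sum of
  -- squares and is halved again, whence `8 * K ^ 2`.
  obtain ⟨K, hK⟩ := hμ.boundedInProbability (η / 12) (by positivity)
  refine ⟨8 * K ^ 2, fun s A hA hdisj => ?_⟩
  set B := {ω | 8 * K ^ 2 < ∑ i ∈ s, μ (A i) ω ^ 2} with hB
  have hBm : MeasurableSet B := measurableSet_lt measurable_const
    (Finset.measurable_fun_sum s fun i _ => (μ (A i)).measurable.pow_const 2)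
  have hhalf : ∀ i : ℕ, (0 : ℝ) ≤ (fun _ => 1 / 2 : ℕ → ℝ) i ∧
    (fun _ => 1 / 2 : ℕ → ℝ) i ≤ 1 := by intro i; norm_num
  have h := le_randomSubsetAvg_measureReal (P := P) (fun _ => 1 / 2) s
    (S := fun t => {ω | K < |μ (⋃ i ∈ t, A i) ω|}) (fun t _ => measurableSet_lt_abs _ _) hBm
    (c := 1 / 12) ?_
  · have h1 : randomSubsetAvg (fun _ => 1 / 2) s
        (fun t => P.real (B ∩ {ω | K < |μ (⋃ i ∈ t, A i) ω|})) ≤ η / 12 := by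
      refine (randomSubsetAvg_mono hhalf s (ψ := fun _ => η / 12) fun t ht => ?_).trans_eq
        (randomSubsetAvg_const _ _ _)
      exact (measureReal_mono (inter_subset_inter_left _ (subset_univ B))).trans
        (hK _ (t.measurableSet_biUnion fun i hi => hA i (ht hi)) (subset_univ _))
    linarith
  · filter_upwards [hμ.ae_apply_biUnion s hA hdisj] with ω hω hωB
    refine (randomSubsetAvg_paleyZygmund (fun i => μ (A i) ω) s).trans
      (randomSubsetAvg_mono hhalf s fun t ht => ?_)
    have e : ∑ i ∈ s, (μ (A i) ω / 2) ^ 2 = (∑ i ∈ s, μ (A i) ω ^ 2) / 4 := by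
      rw [Finset.sum_div]; exact Finset.sum_congr rfl fun i _ => by ring
    split_ifs with h1 h2 <;> try norm_num
    refine h2 ?_
    rw [hω t ht]
    rw [e] at h1
    simp only [hB, mem_ofPred_eq] at hωB
    refine lt_of_le_of_lt (le_abs_self K) (sq_lt_sq.1 ?_)
    nlinarith [sq_nonneg (∑ i ∈ s, μ (A i) ω / 2)]

end Boundedness

/-! ### Calculus of the primitive and the trapezoidal rule. -/

section Primitive

variable {f : ℝ × ℝ → ℝ}

lemma hasDerivAt_fst_of_contDiff (hf : ContDiff ℝ 1 f) (y v : ℝ) :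
    HasDerivAt (fun y => f (y, v)) (fderiv ℝ f (y, v) (1, 0)) y :=
  ((hf.differentiable one_ne_zero (y, v)).hasFDerivAt).comp_hasDerivAt y
    ((hasDerivAt_id y).prodMk (hasDerivAt_const y v))

lemma hasDerivAt_snd_of_contDiff (hf : ContDiff ℝ 1 f) (y v : ℝ) :
    HasDerivAt (fun v => f (y, v)) (fderiv ℝ f (y, v) (0, 1)) v :=
  ((hf.differentiable one_ne_zero (y, v)).hasFDerivAt).comp_hasDerivAt v
    ((hasDerivAt_const v y).prodMk (hasDerivAt_id v))

lemma continuous_fderiv_apply (hf : ContDiff ℝ 1 f) (e : ℝ × ℝ) :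
    Continuous fun p => fderiv ℝ f p e :=
  (hf.continuous_fderiv one_ne_zero).clm_apply continuous_const

lemma hasDerivAt_primitiveFst_snd (hf : ContDiff ℝ 1 f) (x v : ℝ) :
    HasDerivAt (fun w => primitiveFst f x w) (∫ y in (0 : ℝ)..x, fderiv ℝ f (y, v) (0, 1)) v := by
  have hc := continuous_fderiv_apply hf (0, 1)
  have hK : IsCompact (uIcc 0 x ×ˢ Icc (v - 1) (v + 1)) := isCompact_uIcc.prod isCompact_Icc
  obtain ⟨C, hC⟩ := hK.exists_bound_of_continuousOn hc.continuousOn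
  refine (intervalIntegral.hasDerivAt_integral_of_dominated_loc_of_deriv_le
    (F := fun w y => f (y, w)) (F' := fun w y => fderiv ℝ f (y, w) (0, 1)) (bound := fun _ => C)
    (s := Icc (v - 1) (v + 1)) (Icc_mem_nhds (by linarith) (by linarith)) ?_ ?_ ?_ ?_ ?_ ?_).2
  · exact Eventually.of_forall fun w =>
      (hf.continuous.comp (continuous_id.prodMk continuous_const)).aestronglyMeasurable
  · exact (hf.continuous.comp (continuous_id.prodMk continuous_const)).intervalIntegrable _ _
  · exact (hc.comp (continuous_id.prodMk continuous_const)).aestronglyMeasurable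
  · exact Eventually.of_forall fun y hy w hw => hC (y, w) ⟨uIoc_subset_uIcc hy, hw⟩
  · exact intervalIntegrable_const
  · exact Eventually.of_forall fun y _ w _ => hasDerivAt_snd_of_contDiff hf y w

lemma primitiveFstDerivSnd_eq (hf : ContDiff ℝ 1 f) (x v : ℝ) :
    primitiveFstDerivSnd f x v = ∫ y in (0 : ℝ)..x, fderiv ℝ f (y, v) (0, 1) :=
  (hasDerivAt_primitiveFst_snd hf x v).deriv

lemma continuous_primitiveFstDerivSnd (hf : ContDiff ℝ 1 f) :
    Continuous fun p : ℝ × ℝ => primitiveFstDerivSnd f p.1 p.2 := by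
  simp only [primitiveFstDerivSnd_eq hf]
  exact intervalIntegral.continuous_parametric_intervalIntegral_of_continuous
    (f := fun (p : ℝ × ℝ) (y : ℝ) => fderiv ℝ f (y, p.2) (0, 1))
    ((continuous_fderiv_apply hf (0, 1)).comp (by fun_prop)) continuous_fst

lemma continuous_primitiveFst (hf : ContDiff ℝ 1 f) :
    Continuous fun p : ℝ × ℝ => primitiveFst f p.1 p.2 :=
  intervalIntegral.continuous_parametric_intervalIntegral_of_continuous
    (f := fun (p : ℝ × ℝ) (y : ℝ) => f (y, p.2))
    (hf.continuous.comp (by fun_prop)) continuous_fst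

lemma hasDerivAt_primitiveFst_fst (hf : ContDiff ℝ 1 f) (x v : ℝ) :
    HasDerivAt (fun y => primitiveFst f y v) (f (x, v)) x :=
  ((hf.continuous.comp (continuous_id.prodMk continuous_const)).integral_hasStrictDerivAt
    0 x).hasDerivAt

lemma abs_image_sub_sub_le {h h' : ℝ → ℝ} {a b c ε : ℝ}
    (hd : ∀ x ∈ uIcc a b, HasDerivAt h (h' x) x) (hb : ∀ x ∈ uIcc a b, |h' x - c| ≤ ε) :
    |h b - h a - c * (b - a)| ≤ ε * |b - a| := by
  have := Convex.norm_image_sub_le_of_norm_hasDerivWithin_le (f := fun x => h x - c * x)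
    (f' := fun x => h' x - c) (s := uIcc a b) (x := a) (y := b) (C := ε)
    (fun x hx =>
      (((hd x hx).sub ((hasDerivAt_id x).const_mul c)).congr_deriv (by simp)).hasDerivWithinAt)
    hb (convex_uIcc a b) left_mem_uIcc right_mem_uIcc
  rw [Real.norm_eq_abs, Real.norm_eq_abs] at this
  convert this using 2
  ring

/-- Error of the trapezoidal rule for a function whose derivative oscillates by at most `ε`. -/
lemma abs_trapezoid_sub_le {Φ φ φ' : ℝ → ℝ} {a b ε : ℝ}
    (hΦ : ∀ x ∈ uIcc a b, HasDerivAt Φ (φ x) x) (hφ : ∀ x ∈ uIcc a b, HasDerivAt φ (φ' x) x)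
    (hb : ∀ x ∈ uIcc a b, ∀ y ∈ uIcc a b, |φ' x - φ' y| ≤ ε) :
    |(φ a + φ b) / 2 * (b - a) - (Φ b - Φ a)| ≤ ε / 2 * (b - a) ^ 2 := by
  have hε : 0 ≤ ε := (abs_nonneg _).trans (hb a left_mem_uIcc a left_mem_uIcc)
  have hsub : ∀ y ∈ uIcc a b, uIcc a y ⊆ uIcc a b := fun y hy => uIcc_subset_uIcc_left hy
  -- The error is differentiated in its right endpoint `y`: the derivative is half of `φ y - φ a -
  -- φ' y * (y - a)`, which needs only one derivative of `φ`.
  have h := abs_image_sub_sub_le (a := a) (b := b) (c := 0) (ε := ε / 2 * |b - a|)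
    (h := fun y => Φ y - (φ a + φ y) / 2 * (y - a))
    (h' := fun y => φ y - (φ' y / 2 * (y - a) + (φ a + φ y) / 2 * 1))
    (fun y hy => (hΦ y hy).sub ((((hφ y hy).const_add (φ a)).div_const 2).mul
      ((hasDerivAt_id y).sub_const a)))
    (fun y hy => by
      have h1 := abs_image_sub_sub_le (a := a) (b := y) (c := φ' y) (ε := ε)
        (fun x hx => hφ x (hsub y hy hx)) (fun x hx => hb x (hsub y hy hx) y hy)
      have h2 : |y - a| ≤ |b - a| := abs_sub_left_of_mem_uIcc hy
      have e : φ y - (φ' y / 2 * (y - a) + (φ a + φ y) / 2 * 1) - 0 =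
          (φ y - φ a - φ' y * (y - a)) / 2 := by ring
      rw [e, abs_div, abs_two]
      nlinarith)
  have e1 : ε / 2 * |b - a| * |b - a| = ε / 2 * (b - a) ^ 2 := by
    rw [mul_assoc, abs_mul_abs_self, sq]
  rw [e1] at h
  rw [abs_sub_comm]
  convert h using 2
  ring

/-- The path from `(a, u)` to `(b, w)` is taken through `(b, u)`: a trapezoid error in `x`, a
first-order Taylor error in `v`, and a mixed term from replacing `f (b, u)` by `f (b, w)`. -/
lemma abs_trapezoid_primitiveFst_sub_le (hf : ContDiff ℝ 1 f) {a b u w ε C : ℝ}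
    (h1 : ∀ x ∈ uIcc a b, ∀ y ∈ uIcc a b,
      |fderiv ℝ f (x, u) (1, 0) - fderiv ℝ f (y, u) (1, 0)| ≤ ε)
    (h2 : ∀ v ∈ uIcc u w, |primitiveFstDerivSnd f b v - primitiveFstDerivSnd f b w| ≤ ε)
    (h3 : ∀ v ∈ uIcc u w, |fderiv ℝ f (b, v) (0, 1)| ≤ C) :
    |(f (a, u) + f (b, w)) / 2 * (b - a) - (primitiveFst f b w - primitiveFst f a u -
      primitiveFstDerivSnd f b w * (w - u))| ≤
      ε / 2 * (b - a) ^ 2 + ε * |w - u| + C / 2 * |w - u| * |b - a| := by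
  have e1 := abs_trapezoid_sub_le (fun x _ => hasDerivAt_primitiveFst_fst hf x u)
    (fun x _ => hasDerivAt_fst_of_contDiff hf x u) h1
  have e2 := abs_image_sub_sub_le (h := fun v => primitiveFst f b v)
    (fun v _ => by
      have := hasDerivAt_primitiveFst_snd hf b v
      rwa [← primitiveFstDerivSnd_eq hf] at this) h2
  have e3 := abs_image_sub_sub_le (h := fun v => f (b, v)) (c := 0)
    (fun v _ => hasDerivAt_snd_of_contDiff hf b v) (fun v hv => by simpa using h3 v hv)
  have e4 : |(f (b, w) - f (b, u)) / 2 * (b - a)| ≤ C / 2 * |w - u| * |b - a| := by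
    rw [abs_mul, abs_div, abs_two]
    rw [zero_mul, sub_zero] at e3
    have := mul_le_mul_of_nonneg_right e3 (abs_nonneg (b - a))
    linarith
  have key : (f (a, u) + f (b, w)) / 2 * (b - a) - (primitiveFst f b w - primitiveFst f a u -
      primitiveFstDerivSnd f b w * (w - u)) =
      ((f (a, u) + f (b, u)) / 2 * (b - a) - (primitiveFst f b u - primitiveFst f a u)) -
      (primitiveFst f b w - primitiveFst f b u - primitiveFstDerivSnd f b w * (w - u)) +
      (f (b, w) - f (b, u)) / 2 * (b - a) := by ring
  rw [key]
  refine (abs_add_le _ _).trans (add_le_add ((abs_sub _ _).trans (add_le_add e1 e2)) e4)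

end Primitive

/-! ### Existence of Riemann–Stieltjes integrals. -/

section Stieltjes

lemma uniform_continuousOn_Icc {g : ℝ → ℝ} {a b : ℝ} (hg : ContinuousOn g (Icc a b)) {ε : ℝ}
    (hε : 0 < ε) :
    ∃ δ > 0, ∀ x ∈ Icc a b, ∀ y ∈ Icc a b, |x - y| < δ → |g x - g y| < ε :=
  Metric.uniformContinuousOn_iff.1 (isCompact_Icc.uniformContinuousOn_of_continuous hg) ε hε

lemma mem_Icc_of_partition {x : ℕ → ℝ} {N : ℕ} {a b : ℝ} (h0 : x 0 = a) (hN : x N = b)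
    (hx : ∀ k < N, x k ≤ x (k + 1)) {k : ℕ} (hk : k ≤ N) : x k ∈ Icc a b := by
  have hmono : MonotoneOn x (Iic N) := by
    refine monotoneOn_of_le_add_one (ordConnected_Iic) fun k _ _ hk' => hx k ?_
    exact Nat.lt_of_succ_le hk'
  rw [← h0, ← hN]
  exact ⟨hmono (mem_Iic.2 (Nat.zero_le N)) hk (Nat.zero_le k), hmono hk (mem_Iic.2 le_rfl) hk⟩

lemma abs_sum_mul_measureReal_sub_integral_le (ρ : Measure ℝ) [IsFiniteMeasure ρ] {g : ℝ → ℝ}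
    {a b ε δ : ℝ} (hg : ContinuousOn g (Icc a b)) (hε : 0 ≤ ε)
    (hδ : ∀ x ∈ Icc a b, ∀ y ∈ Icc a b, |x - y| < δ → |g x - g y| < ε)
    {N : ℕ} {x s : ℕ → ℝ} (h0 : x 0 = a) (hN : x N = b)
    (hx : ∀ k < N, x k ≤ s k ∧ s k ≤ x (k + 1) ∧ x (k + 1) - x k < δ) :
    |∑ k ∈ Finset.range N, g (s k) * ρ.real (Ioc (x k) (x (k + 1))) - ∫ t in a..b, g t ∂ρ| ≤
      ε * ρ.real univ := by
  have hle : ∀ k < N, x k ≤ x (k + 1) := fun k hk => (hx k hk).1.trans (hx k hk).2.1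
  have hmem : ∀ k ≤ N, x k ∈ Icc a b := fun k hk => mem_Icc_of_partition h0 hN hle hk
  have hab : a ≤ b := h0 ▸ (hmem 0 (Nat.zero_le N)).2
  have hsub : ∀ k < N, Icc (x k) (x (k + 1)) ⊆ Icc a b := fun k hk =>
    Icc_subset_Icc (hmem k hk.le).1 (hmem (k + 1) hk).2
  have hint : ∀ k < N, IntervalIntegrable g ρ (x k) (x (k + 1)) := fun k hk =>
    ContinuousOn.intervalIntegrable_of_Icc (hle k hk) (hg.mono (hsub k hk))
  rw [← h0, ← hN, ← intervalIntegral.sum_integral_adjacent_intervals hint,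
    ← Finset.sum_sub_distrib]
  have hterm : ∀ k ∈ Finset.range N, |g (s k) * ρ.real (Ioc (x k) (x (k + 1))) -
      ∫ t in x k..x (k + 1), g t ∂ρ| ≤ ε * ∫ _t in x k..x (k + 1), (1 : ℝ) ∂ρ := by
    intro k hk
    have hk := Finset.mem_range.1 hk
    have hsk : s k ∈ Icc a b := hsub k hk ⟨(hx k hk).1, (hx k hk).2.1⟩
    have e1 : g (s k) * ρ.real (Ioc (x k) (x (k + 1))) - ∫ t in x k..x (k + 1), g t ∂ρ =
        ∫ t in Ioc (x k) (x (k + 1)), (g (s k) - g t) ∂ρ := by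
      rw [intervalIntegral.integral_of_le (hle k hk),
        integral_sub (by simp) (hint k hk).1]
      simp [mul_comm]
    have e2 : ∫ _t in x k..x (k + 1), (1 : ℝ) ∂ρ = ρ.real (Ioc (x k) (x (k + 1))) := by
      rw [intervalIntegral.integral_of_le (hle k hk)]; simp
    rw [e1, e2, ← Real.norm_eq_abs]
    refine norm_setIntegral_le_of_norm_le_const (measure_lt_top _ _) fun t ht => ?_
    refine (hδ _ hsk t (hsub k hk (Ioc_subset_Icc_self ht)) ?_).le
    have := hx k hk
    rw [abs_lt]
    constructor <;> linarith [ht.1, ht.2]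
  refine (Finset.abs_sum_le_sum_abs _ _).trans ((Finset.sum_le_sum hterm).trans ?_)
  rw [← Finset.mul_sum, intervalIntegral.sum_integral_adjacent_intervals (fun k _ => by simp)]
  refine mul_le_mul_of_nonneg_left ?_ hε
  rw [h0, hN, intervalIntegral.integral_of_le hab]
  simpa using measureReal_mono (μ := ρ) (subset_univ (Ioc a b))

/-- A continuous function is Riemann–Stieltjes integrable with respect to a continuous function of
bounded variation. -/
lemma exists_hasStieltjesIntegral {g v : ℝ → ℝ} {T : ℝ} (hT : 0 ≤ T)
    (hg : ContinuousOn g (Icc 0 T)) (hv : ContinuousOn v (Icc 0 T))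
    (hbv : BoundedVariationOn v (Icc 0 T)) : ∃ I, HasStieltjesIntegral g v 0 T I := by
  -- Constant extension of `v` beyond `[0, T]`, continuous and of bounded variation on the line. By
  -- continuity its Stieltjes measure gives `Ioc a b` the mass `v b - v a`, and the Jordan
  -- decomposition reduces to positive measures.
  let w : ℝ → ℝ := v ∘ fun t => (projIcc 0 T hT t : ℝ)
  have hwc : Continuous w := hv.comp_continuous
    (continuous_subtype_val.comp continuous_projIcc) fun t => (projIcc 0 T hT t).2
  have hwv : ∀ t ∈ Icc 0 T, w t = v t := fun t ht => by
    simp only [w, Function.comp_apply, projIcc_of_mem hT ht]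
  have hwbv : BoundedVariationOn w univ := by
    refine ne_top_of_le_ne_top hbv (eVariationOn.comp_le_of_monotoneOn v _ ?_ ?_)
    · exact fun a _ b _ hab => monotone_projIcc hT hab
    · exact fun t _ => (projIcc 0 T hT t).2
  have hr : ∀ t, w.rightLim t = w t := fun t => hwc.continuousWithinAt.rightLim_eq
  let ν : SignedMeasure ℝ := hwbv.vectorMeasure
  let ρ₁ := ν.toJordanDecomposition.posPart
  let ρ₂ := ν.toJordanDecomposition.negPart
  have hν : ∀ a ∈ Icc 0 T, ∀ b ∈ Icc 0 T, a ≤ b →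
      v b - v a = ρ₁.real (Ioc a b) - ρ₂.real (Ioc a b) := by
    intro a ha b hb hab
    have h1 := hwbv.vectorMeasure_Ioc hab
    rw [hr, hr, hwv a ha, hwv b hb] at h1
    rw [← h1]
    have h2 := congrArg (fun s : SignedMeasure ℝ => s (Ioc a b))
      ν.toSignedMeasure_toJordanDecomposition
    simp only [JordanDecomposition.toSignedMeasure, sub_apply,
      Measure.toSignedMeasure_apply_measurable measurableSet_Ioc] at h2
    exact h2.symm
  refine ⟨(∫ t in (0 : ℝ)..T, g t ∂ρ₁) - ∫ t in (0 : ℝ)..T, g t ∂ρ₂, fun ε hε => ?_⟩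
  set R := ρ₁.real univ + ρ₂.real univ with hR
  have hR0 : 0 ≤ R := add_nonneg measureReal_nonneg measureReal_nonneg
  have hε' : 0 < ε / (R + 1) := by positivity
  obtain ⟨δ, hδ, hosc⟩ := uniform_continuousOn_Icc hg hε'
  refine ⟨δ, hδ, fun N x s h0 hN hx => ?_⟩
  have hle : ∀ k < N, x k ≤ x (k + 1) := fun k hk => (hx k hk).1.trans (hx k hk).2.1
  have h1 := abs_sum_mul_measureReal_sub_integral_le ρ₁ hg hε'.le hosc h0 hN hx
  have h2 := abs_sum_mul_measureReal_sub_integral_le ρ₂ hg hε'.le hosc h0 hN hx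
  have e : ∑ k ∈ Finset.range N, g (s k) * (v (x (k + 1)) - v (x k)) =
      ∑ k ∈ Finset.range N, g (s k) * ρ₁.real (Ioc (x k) (x (k + 1))) -
        ∑ k ∈ Finset.range N, g (s k) * ρ₂.real (Ioc (x k) (x (k + 1))) := by
    rw [← Finset.sum_sub_distrib]
    refine Finset.sum_congr rfl fun k hk => ?_
    have hk := Finset.mem_range.1 hk
    rw [hν _ (mem_Icc_of_partition h0 hN hle hk.le) _ (mem_Icc_of_partition h0 hN hle hk)
      (hle k hk)]
    ring
  rw [e]
  set S₁ := ∑ k ∈ Finset.range N, g (s k) * ρ₁.real (Ioc (x k) (x (k + 1)))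
  set S₂ := ∑ k ∈ Finset.range N, g (s k) * ρ₂.real (Ioc (x k) (x (k + 1)))
  have h3 := abs_sub (S₁ - ∫ t in (0 : ℝ)..T, g t ∂ρ₁) (S₂ - ∫ t in (0 : ℝ)..T, g t ∂ρ₂)
  have e2 : S₁ - S₂ - ((∫ t in (0 : ℝ)..T, g t ∂ρ₁) - ∫ t in (0 : ℝ)..T, g t ∂ρ₂) =
      (S₁ - ∫ t in (0 : ℝ)..T, g t ∂ρ₁) - (S₂ - ∫ t in (0 : ℝ)..T, g t ∂ρ₂) := by ring
  rw [e2]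
  have h4 : ε / (R + 1) * R < ε := by
    rw [div_mul_eq_mul_div, div_lt_iff₀ (by positivity)]
    nlinarith
  rw [hR, mul_add] at h4
  linarith

lemma sum_abs_sub_le_eVariationOn {v : ℝ → ℝ} {a b : ℝ} (hbv : BoundedVariationOn v (Icc a b))
    {x : ℕ → ℝ} {N : ℕ} (h0 : x 0 = a) (hN : x N = b) (hx : ∀ k < N, x k ≤ x (k + 1)) :
    ∑ k ∈ Finset.range N, |v (x (k + 1)) - v (x k)| ≤ (eVariationOn v (Icc a b)).toReal := by
  have hmono : MonotoneOn x (Iic N) :=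
    monotoneOn_of_le_add_one ordConnected_Iic fun k _ _ hk' => hx k (Nat.lt_of_succ_le hk')
  have h := eVariationOn.sum_le_of_monotoneOn_Iic (f := v) (s := Icc a b) hmono
    fun i hi => mem_Icc_of_partition h0 hN hx hi
  have h2 := ENNReal.toReal_mono hbv h
  rw [ENNReal.toReal_sum fun _ _ => edist_ne_top _ _] at h2
  simpa only [edist_dist, Real.dist_eq, ENNReal.toReal_ofReal (abs_nonneg _)] using h2

end Stieltjes

/-! ### The pathwise change of variables estimate. -/

section Pathwise

/-- Along continuous paths, the trapezoidal sums differ from the right-hand side of the change of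
variables formula by at most `ε * (1 + ∑ (Δm) ^ 2)` once the mesh is small. -/
lemma exists_mesh_abs_trapezoidSum_sub_le {f : ℝ × ℝ → ℝ} (hf : ContDiff ℝ 1 f) {m v : ℝ → ℝ}
    {T J : ℝ} (hm : ContinuousOn m (Icc 0 T)) (hv : ContinuousOn v (Icc 0 T))
    (hbv : BoundedVariationOn v (Icc 0 T))
    (hJ : HasStieltjesIntegral (fun t => primitiveFstDerivSnd f (m t) (v t)) v 0 T J)
    {ε : ℝ} (hε : 0 < ε) :
    ∃ δ > 0, ∀ (N : ℕ) (x : ℕ → ℝ), x 0 = 0 → x N = T →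
      (∀ k < N, x k ≤ x (k + 1) ∧ x (k + 1) - x k < δ) →
      |∑ k ∈ Finset.range N, (f (m (x k), v (x k)) + f (m (x (k + 1)), v (x (k + 1)))) / 2 *
          (m (x (k + 1)) - m (x k)) -
        (primitiveFst f (m T) (v T) - primitiveFst f (m 0) (v 0) - J)| ≤
      ε * (1 + ∑ k ∈ Finset.range N, (m (x (k + 1)) - m (x k)) ^ 2) := by
  obtain ⟨A, hA⟩ := isCompact_Icc.exists_bound_of_continuousOn hm
  obtain ⟨B, hB⟩ := isCompact_Icc.exists_bound_of_continuousOn hv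
  have hmA : ∀ t ∈ Icc 0 T, m t ∈ Icc (-A) A := fun t ht => abs_le.1 (hA t ht)
  have hvB : ∀ t ∈ Icc 0 T, v t ∈ Icc (-B) B := fun t ht => abs_le.1 (hB t ht)
  have hK : IsCompact (Icc (-A) A ×ˢ Icc (-B) B) := isCompact_Icc.prod isCompact_Icc
  obtain ⟨C₀, hC₀⟩ := hK.exists_bound_of_continuousOn (continuous_fderiv_apply hf (0, 1)).continuousOn
  obtain ⟨C, hC0, hC⟩ : ∃ C, 0 ≤ C ∧ ∀ p ∈ Icc (-A) A ×ˢ Icc (-B) B,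
      |fderiv ℝ f p (0, 1)| ≤ C :=
    ⟨|C₀|, abs_nonneg _, fun p hp => (hC₀ p hp).trans (le_abs_self _)⟩
  set R := (eVariationOn v (Icc 0 T)).toReal with hR
  have hR0 : 0 ≤ R := ENNReal.toReal_nonneg
  -- The errors not involving `(Δm) ^ 2` total `ε₁ * D`: the Taylor and mixed terms over the total
  -- variation `R`, plus one `ε₁` for the Stieltjes sum.
  set D := 1 + (1 + C / 2) * R with hD
  have hD1 : 1 ≤ D := by
    have : 0 ≤ (1 + C / 2) * R := by positivity
    linarith
  set ε₁ := ε / D with hε₁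
  have hε₁0 : 0 < ε₁ := by positivity
  have hε₁D : ε₁ * D = ε := div_mul_cancel₀ _ (by positivity)
  have hε₁ε : ε₁ ≤ ε := by nlinarith
  obtain ⟨δ₁, hδ₁, h1⟩ := Metric.uniformContinuousOn_iff.1
    (hK.uniformContinuousOn_of_continuous (continuous_fderiv_apply hf (1, 0)).continuousOn) ε₁ hε₁0
  obtain ⟨δ₂, hδ₂, h2⟩ := Metric.uniformContinuousOn_iff.1
    (hK.uniformContinuousOn_of_continuous (continuous_primitiveFstDerivSnd hf).continuousOn) ε₁ hε₁0
  obtain ⟨δ₃, hδ₃, h3⟩ := uniform_continuousOn_Icc hm (lt_min hδ₁ hε₁0)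
  obtain ⟨δ₄, hδ₄, h4⟩ := uniform_continuousOn_Icc hv hδ₂
  obtain ⟨δ₅, hδ₅, h5⟩ := hJ ε₁ hε₁0
  refine ⟨min δ₃ (min δ₄ δ₅), lt_min hδ₃ (lt_min hδ₄ hδ₅), fun N x h0 hN hx => ?_⟩
  have hle : ∀ k < N, x k ≤ x (k + 1) := fun k hk => (hx k hk).1
  have hmem : ∀ k ≤ N, x k ∈ Icc 0 T := fun k hk => mem_Icc_of_partition h0 hN hle hk
  have hterm : ∀ k ∈ Finset.range N,
      |(f (m (x k), v (x k)) + f (m (x (k + 1)), v (x (k + 1)))) / 2 *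
          (m (x (k + 1)) - m (x k)) -
        (primitiveFst f (m (x (k + 1))) (v (x (k + 1))) - primitiveFst f (m (x k)) (v (x k)) -
          primitiveFstDerivSnd f (m (x (k + 1))) (v (x (k + 1))) * (v (x (k + 1)) - v (x k)))| ≤
        ε₁ / 2 * (m (x (k + 1)) - m (x k)) ^ 2 +
          ε₁ * (1 + C / 2) * |v (x (k + 1)) - v (x k)| := by
    intro k hk
    have hk := Finset.mem_range.1 hk
    have hk0 := hmem k hk.le
    have hk1 := hmem (k + 1) hk
    have hxk : |x (k + 1) - x k| < min δ₃ (min δ₄ δ₅) := by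
      rw [abs_of_nonneg (sub_nonneg.2 (hle k hk))]
      exact (hx k hk).2
    have hm' := h3 _ hk1 _ hk0 (hxk.trans_le (min_le_left _ _))
    have hv' := h4 _ hk1 _ hk0 (hxk.trans_le ((min_le_right _ _).trans (min_le_left _ _)))
    have hmsub : uIcc (m (x k)) (m (x (k + 1))) ⊆ Icc (-A) A :=
      uIcc_subset_Icc (hmA _ hk0) (hmA _ hk1)
    have hvsub : uIcc (v (x k)) (v (x (k + 1))) ⊆ Icc (-B) B :=
      uIcc_subset_Icc (hvB _ hk0) (hvB _ hk1)
    refine (abs_trapezoid_primitiveFst_sub_le hf (ε := ε₁) (C := C) ?_ ?_ ?_).trans ?_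
    · intro y hy z hz
      refine (h1 (y, _) ⟨hmsub hy, hvB _ hk0⟩ (z, _) ⟨hmsub hz, hvB _ hk0⟩ ?_).le
      rw [Prod.dist_eq, dist_self, max_eq_left dist_nonneg, Real.dist_eq]
      exact (abs_sub_le_of_uIcc_subset_uIcc (uIcc_subset_uIcc hz hy)).trans_lt
        (hm'.trans_le (min_le_left _ _))
    · intro w hw
      refine (h2 (_, w) ⟨hmA _ hk1, hvsub hw⟩ (_, v (x (k + 1))) ⟨hmA _ hk1, hvB _ hk1⟩ ?_).le
      rw [Prod.dist_eq, dist_self, max_eq_right dist_nonneg, Real.dist_eq, abs_sub_comm]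
      exact (abs_sub_right_of_mem_uIcc hw).trans_lt hv'
    · exact fun w hw => hC _ ⟨hmA _ hk1, hvsub hw⟩
    · have h6 : C / 2 * |v (x (k + 1)) - v (x k)| * |m (x (k + 1)) - m (x k)| ≤
          C / 2 * |v (x (k + 1)) - v (x k)| * ε₁ :=
        mul_le_mul_of_nonneg_left (hm'.le.trans (min_le_right _ _)) (by positivity)
      linarith
  -- The tags are right endpoints, where the Taylor expansion in `v` is centred.
  have h5' := h5 N x (fun k => x (k + 1)) h0 hN fun k hk =>
    ⟨hle k hk, le_rfl, (hx k hk).2.trans_le ((min_le_right _ _).trans (min_le_right _ _))⟩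
  have htel := Finset.sum_range_sub (fun k => primitiveFst f (m (x k)) (v (x k))) N
  rw [h0, hN] at htel
  have hvar := sum_abs_sub_le_eVariationOn hbv h0 hN hle
  set Q := ∑ k ∈ Finset.range N, (m (x (k + 1)) - m (x k)) ^ 2 with hQ
  have hQ0 : 0 ≤ Q := Finset.sum_nonneg fun k _ => sq_nonneg _
  have hsum := (Finset.abs_sum_le_sum_abs _ _).trans (Finset.sum_le_sum hterm)
  rw [Finset.sum_add_distrib, ← Finset.mul_sum, ← Finset.mul_sum, ← hQ, Finset.sum_sub_distrib,
    Finset.sum_sub_distrib, htel] at hsum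
  set S := ∑ k ∈ Finset.range N, (f (m (x k), v (x k)) + f (m (x (k + 1)), v (x (k + 1)))) / 2 *
    (m (x (k + 1)) - m (x k))
  set Z := ∑ k ∈ Finset.range N, primitiveFstDerivSnd f (m (x (k + 1))) (v (x (k + 1))) *
    (v (x (k + 1)) - v (x k))
  set ΔF := primitiveFst f (m T) (v T) - primitiveFst f (m 0) (v 0)
  have hfin := abs_sub (S - (ΔF - Z)) (Z - J)
  rw [show S - (ΔF - Z) - (Z - J) = S - (ΔF - J) by ring] at hfin
  have h7 : ε₁ * (1 + C / 2) * ∑ k ∈ Finset.range N, |v (x (k + 1)) - v (x k)| ≤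
      ε₁ * (1 + C / 2) * R := mul_le_mul_of_nonneg_left hvar (by positivity)
  have h8 : ε₁ / 2 * Q ≤ ε * Q := mul_le_mul_of_nonneg_right (by linarith) hQ0
  have h9 : ε₁ * (1 + C / 2) * R + ε₁ = ε := by rw [← hε₁D, hD]; ring
  linarith

end Pathwise

lemma PartitionSeq.mem_Icc {T : ℝ} (π : PartitionSeq T) (n : ℕ) {k : ℕ} (hk : k ≤ π.j n) :
    π.pt n k ∈ Icc 0 T :=
  mem_Icc_of_partition (π.pt_zero n) (π.pt_last n) (fun k hk => (π.pt_lt n k hk).le) hk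

/-! ### Probabilistic conclusions for the processes. -/

section ContinuousPaths

variable {Ω : Type*} [MeasurableSpace Ω] {P : Measure Ω} {T : ℝ}

lemma IsContinuousVersion.aemeasurable {μ : Set (Icc (0 : ℝ) T) → (Ω →ₘ[P] ℝ)} {m : ℝ → Ω → ℝ}
    (hm : IsContinuousVersion P T μ m) {t : ℝ} (ht : t ∈ Icc 0 T) : AEMeasurable (m t) P :=
  (AEEqFun.aemeasurable _).congr (hm.1 t ht).symm

variable [IsProbabilityMeasure P]

/-- Sums of squared increments of a continuous version are bounded in probability. -/
lemma IsContinuousVersion.sum_sq_boundedInProbability {μ : Set (Icc (0 : ℝ) T) → (Ω →ₘ[P] ℝ)}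
    (hμ : IsStochasticMeasure P μ) {m : ℝ → Ω → ℝ} (hm : IsContinuousVersion P T μ m) {η : ℝ}
    (hη : 0 < η) :
    ∃ K : ℝ, ∀ (π : PartitionSeq T) (n : ℕ), P.real {ω | K < ∑ k ∈ Finset.range (π.j n),
      (m (π.pt n (k + 1)) ω - m (π.pt n k) ω) ^ 2} ≤ η := by
  obtain ⟨K, hK⟩ := hμ.sum_sq_boundedInProbability hη
  refine ⟨K, fun π n => ?_⟩
  let A : ℕ → Set (Icc (0 : ℝ) T) := fun k => {s | π.pt n k < (s : ℝ) ∧ (s : ℝ) ≤ π.pt n (k + 1)}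
  let I : ℝ → Set (Icc (0 : ℝ) T) := fun t => {s | 0 < (s : ℝ) ∧ (s : ℝ) ≤ t}
  have hIoc : ∀ a b : ℝ, MeasurableSet {s : Icc (0 : ℝ) T | a < (s : ℝ) ∧ (s : ℝ) ≤ b} :=
    fun a b => measurable_subtype_coe measurableSet_Ioc
  have hmono : MonotoneOn (π.pt n) (Iic (π.j n)) :=
    monotoneOn_of_le_add_one ordConnected_Iic fun k _ _ hk' =>
      (π.pt_lt n k (Nat.lt_of_succ_le hk')).le
  have hdisj : (Finset.range (π.j n) : Set ℕ).PairwiseDisjoint A := by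
    have hlt : ∀ k l, k < l → l < π.j n → Disjoint (A k) (A l) := fun k l hkl hl =>
      disjoint_left.2 fun s hs hs' => by
        have := hmono (mem_Iic.2 (show k + 1 ≤ π.j n by omega)) (mem_Iic.2 hl.le)
          (show k + 1 ≤ l from hkl)
        exact absurd (hs.2.trans this) (not_le.2 hs'.1)
    intro k hk l hl hkl
    rw [Finset.coe_range, mem_Iio] at hk hl
    rcases lt_or_gt_of_ne hkl with h | h
    exacts [hlt k l h hl, (hlt l k h hk).symm]
  have hinc : ∀ᵐ ω ∂P, ∀ k < π.j n, m (π.pt n (k + 1)) ω - m (π.pt n k) ω = μ (A k) ω := by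
    refine ae_all_iff.2 fun k => ?_
    by_cases hk : k < π.j n
    · have h0 := π.mem_Icc n hk.le
      have hU : I (π.pt n (k + 1)) = I (π.pt n k) ∪ A k := by
        ext s
        simp only [I, A, mem_union, mem_ofPred_eq]
        have h1 := (π.pt_lt n k hk).le
        constructor
        · rintro ⟨h2, h3⟩
          by_cases h4 : (s : ℝ) ≤ π.pt n k
          exacts [Or.inl ⟨h2, h4⟩, Or.inr ⟨not_le.1 h4, h3⟩]
        · rintro (⟨h2, h3⟩ | ⟨h2, h3⟩)
          exacts [⟨h2, h3.trans h1⟩, ⟨h0.1.trans_lt h2, h3⟩]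
      have hadd := hμ.apply_union (hIoc 0 (π.pt n k)) (hIoc (π.pt n k) (π.pt n (k + 1)))
        (disjoint_left.2 fun s hs hs' => absurd hs.2 (not_le.2 hs'.1))
      filter_upwards [hm.1 _ h0, hm.1 _ (π.mem_Icc n hk), AEEqFun.coeFn_add (μ (I (π.pt n k)))
        (μ (A k))] with ω h1 h2 h3 _
      have h4 : μ (I (π.pt n (k + 1))) ω = μ (I (π.pt n k)) ω + μ (A k) ω := by
        rw [hU]; exact (congrArg (fun Y : Ω →ₘ[P] ℝ => Y ω) hadd).trans h3
      rw [h1, h2]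
      exact sub_eq_of_eq_add' h4
    · exact Eventually.of_forall fun ω h => absurd h hk
  refine le_trans (measureReal_le_of_ae_imp ?_) (hK (Finset.range (π.j n)) A
    (fun k _ => hIoc _ _) hdisj)
  filter_upwards [hinc] with ω hω h
  refine lt_of_lt_of_eq h (Finset.sum_congr rfl fun k hk => ?_)
  rw [hω k (Finset.mem_range.1 hk)]

omit [IsProbabilityMeasure P] in
/-- The pathwise Riemann–Stieltjes integral of a continuous function of continuous processes is a
random variable. -/
lemma exists_aemeasurable_hasStieltjesIntegral (hT : 0 ≤ T) {m V : ℝ → Ω → ℝ}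
    (hm : ∀ t ∈ Icc 0 T, AEMeasurable (m t) P)
    (hmc : ∀ᵐ ω ∂P, ContinuousOn (fun t => m t ω) (Icc 0 T))
    (hV : IsContinuousBVProcess P T V) {g : ℝ × ℝ → ℝ} (hg : Continuous g) :
    ∃ J : Ω → ℝ, AEMeasurable J P ∧ ∀ᵐ ω ∂P, HasStieltjesIntegral
      (fun t => g (m t ω, V t ω)) (fun t => V t ω) 0 T (J ω) := by
  classical
  have hex : ∀ᵐ ω ∂P, ∃ I, HasStieltjesIntegral
      (fun t => g (m t ω, V t ω)) (fun t => V t ω) 0 T I := by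
    filter_upwards [hmc, hV.2] with ω h1 h2
    exact exists_hasStieltjesIntegral hT (hg.comp_continuousOn (h1.prodMk h2.1)) h2.1 h2.2
  let J : Ω → ℝ := fun ω => if h : ∃ I, HasStieltjesIntegral
    (fun t => g (m t ω, V t ω)) (fun t => V t ω) 0 T I then h.choose else 0
  have hJ : ∀ᵐ ω ∂P, HasStieltjesIntegral
      (fun t => g (m t ω, V t ω)) (fun t => V t ω) 0 T (J ω) := by
    filter_upwards [hex] with ω hω
    simp only [J, dif_pos hω]
    exact hω.choose_spec
  refine ⟨J, ?_, hJ⟩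
  -- Equidistant partitions: their Riemann sums are measurable in `ω` and converge to `J`, whose
  -- pointwise choice carries no measurability.
  let x : ℕ → ℕ → ℝ := fun n k => k * (T / (n + 1))
  have hx : ∀ n k, k ≤ n + 1 → x n k ∈ Icc 0 T := by
    intro n k hk
    have hk' : (k : ℝ) ≤ n + 1 := by exact_mod_cast hk
    refine ⟨by positivity, ?_⟩
    calc (k : ℝ) * (T / (n + 1)) ≤ (n + 1) * (T / (n + 1)) := by gcongr
      _ = T := by field_simp
  refine aemeasurable_of_tendsto_metrizable_ae atTop (f := fun (n : ℕ) ω =>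
    ∑ k ∈ Finset.range (n + 1), g (m (x n k) ω, V (x n k) ω) * (V (x n (k + 1)) ω - V (x n k) ω))
    (fun n => ?_) ?_
  · refine Finset.aemeasurable_fun_sum _ fun k hk => ?_
    have hk := Finset.mem_range.1 hk
    have h0 := hx n k hk.le
    have h1 := hx n (k + 1) hk
    exact (hg.measurable.comp_aemeasurable ((hm _ h0).prodMk (hV.1 _ h0))).mul
      ((hV.1 _ h1).sub (hV.1 _ h0))
  · filter_upwards [hJ] with ω hω
    rw [Metric.tendsto_atTop]
    intro ε hε
    obtain ⟨δ, hδ, h⟩ := hω ε hε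
    have hlim : Tendsto (fun n : ℕ => T * (1 / ((n : ℝ) + 1))) atTop (nhds (T * 0)) :=
      tendsto_one_div_add_atTop_nhds_zero_nat.const_mul T
    rw [mul_zero] at hlim
    obtain ⟨n₀, hn₀⟩ := eventually_atTop.1 (hlim.eventually (gt_mem_nhds hδ))
    refine ⟨n₀, fun n hn => ?_⟩
    rw [Real.dist_eq]
    have hn := hn₀ n hn
    refine h (n + 1) (x n) (x n) (by simp [x]) (by simp only [x]; push_cast; field_simp)
      fun k hk => ⟨le_rfl, ?_, ?_⟩
    · simp only [x]; push_cast
      have : 0 ≤ T / ((n : ℝ) + 1) := by positivity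
      linarith
    · simp only [x]; push_cast
      have : ((k : ℝ) + 1) * (T / (n + 1)) - k * (T / (n + 1)) = T * (1 / ((n : ℝ) + 1)) := by ring
      rw [this]
      exact hn

/-- If `U n / (1 + Q n)` tends to zero almost surely and `Q n` is bounded in probability, then
`U n` tends to zero in probability. -/
lemma tendsto_measureReal_of_div_tendsto {U Q : ℕ → Ω → ℝ} (hU : ∀ n, AEMeasurable (U n) P)
    (hQ : ∀ n, AEMeasurable (Q n) P) (hQ0 : ∀ n ω, 0 ≤ Q n ω)
    (hbdd : ∀ η : ℝ, 0 < η → ∃ K : ℝ, ∀ n, P.real {ω | K < Q n ω} ≤ η)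
    (hlim : ∀ᵐ ω ∂P, Tendsto (fun n => U n ω / (1 + Q n ω)) atTop (nhds 0)) {ε : ℝ} (hε : 0 < ε) :
    Tendsto (fun n => P.real {ω | ε ≤ |U n ω|}) atTop (nhds 0) := by
  have hmeas := tendstoInMeasure_iff_measureReal_norm.1 (tendstoInMeasure_of_tendsto_ae (μ := P)
    (f := fun n ω => U n ω / (1 + Q n ω)) (g := fun _ => 0)
    (fun n => ((hU n).div ((hQ n).const_add 1)).aestronglyMeasurable) hlim)
  rw [Metric.tendsto_atTop]
  intro η hη
  obtain ⟨K, hK⟩ := hbdd (η / 2) (half_pos hη)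
  have hpos : 0 < 1 + |K| := by positivity
  obtain ⟨n₀, hn₀⟩ := eventually_atTop.1
    ((hmeas (ε / (1 + |K|)) (by positivity)).eventually (gt_mem_nhds (half_pos hη)))
  refine ⟨n₀, fun n hn => ?_⟩
  rw [Real.dist_eq, sub_zero, abs_of_nonneg measureReal_nonneg]
  have hsub : {ω | ε ≤ |U n ω|} ⊆
      {ω | K < Q n ω} ∪ {ω | ε / (1 + |K|) ≤ ‖U n ω / (1 + Q n ω) - 0‖} := by
    intro ω hω
    simp only [mem_union, mem_ofPred_eq, sub_zero, Real.norm_eq_abs] at hω ⊢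
    by_cases h : K < Q n ω
    · exact Or.inl h
    · refine Or.inr ?_
      have h1 : 0 < 1 + Q n ω := by linarith [hQ0 n ω]
      rw [abs_div, abs_of_pos h1]
      exact div_le_div₀ (abs_nonneg _) hω h1 (by linarith [le_abs_self K])
  linarith [(measureReal_mono (μ := P) hsub).trans (measureReal_union_le _ _), hK n, hn₀ n hn]

end ContinuousPaths

end

theorem mainTheorem1 {Ω : Type*} [MeasurableSpace Ω] (P : Measure Ω) [IsProbabilityMeasure P]
    (T : ℝ) (hT : 0 < T)
    (μ : Set (Icc (0 : ℝ) T) → (Ω →ₘ[P] ℝ)) (hμ : IsStochasticMeasure P μ)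
    (m : ℝ → Ω → ℝ) (hm : IsContinuousVersion P T μ m)
    (V : ℝ → Ω → ℝ) (hV : IsContinuousBVProcess P T V)
    (f : ℝ × ℝ → ℝ) (hf : ContDiff ℝ 1 f) :
    (∀ x v : ℝ, DifferentiableAt ℝ (fun w => primitiveFst f x w) v) ∧
    ∃ J : Ω → ℝ,
      AEMeasurable J P ∧
      (∀ᵐ ω ∂P, HasStieltjesIntegral
        (fun t => primitiveFstDerivSnd f (m t ω) (V t ω)) (fun t => V t ω) 0 T (J ω)) ∧
      HasStratonovichIntegral P T (fun t ω => f (m t ω, V t ω)) m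
        (fun ω => primitiveFst f (m T ω) (V T ω) - primitiveFst f (m 0 ω) (V 0 ω) - J ω) := by

  refine ⟨fun x v => (hasDerivAt_primitiveFst_snd hf x v).differentiableAt, ?_⟩
  obtain ⟨J, hJm, hJ⟩ := exists_aemeasurable_hasStieltjesIntegral hT.le
    (fun t ht => hm.aemeasurable ht) hm.2 hV (continuous_primitiveFstDerivSnd hf)
  have h0 : (0 : ℝ) ∈ Icc 0 T := left_mem_Icc.2 hT.le
  have h1 : T ∈ Icc 0 T := right_mem_Icc.2 hT.le
  have hFm : ∀ t ∈ Icc 0 T, AEMeasurable (fun ω => primitiveFst f (m t ω) (V t ω)) P :=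
    fun t ht => (continuous_primitiveFst hf).measurable.comp_aemeasurable
      ((hm.aemeasurable ht).prodMk (hV.1 t ht))
  have hIm := ((hFm T h1).sub (hFm 0 h0)).sub hJm
  refine ⟨J, hJm, hJ, hIm, fun π => tendstoInMeasure_iff_measureReal_norm.2 fun ε hε => ?_⟩
  have hfm : ∀ t ∈ Icc 0 T, AEMeasurable (fun ω => f (m t ω, V t ω)) P := fun t ht =>
    hf.continuous.measurable.comp_aemeasurable ((hm.aemeasurable ht).prodMk (hV.1 t ht))
  -- The mesh threshold in the pathwise estimate depends on `ω`, so that estimate gives only almost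
  -- sure convergence of the quotient; the uniform bound on `Q` removes the denominator.
  refine tendsto_measureReal_of_div_tendsto
    (Q := fun n ω => ∑ k ∈ Finset.range (π.j n), (m (π.pt n (k + 1)) ω - m (π.pt n k) ω) ^ 2)
    (fun n => AEMeasurable.sub ?_ hIm) (fun n => ?_)
    (fun n ω => Finset.sum_nonneg fun k _ => sq_nonneg _) (fun η hη => ?_) ?_ hε
  · refine Finset.aemeasurable_fun_sum _ fun k hk => ?_
    have hk0 := π.mem_Icc n (Finset.mem_range.1 hk).le
    have hk1 := π.mem_Icc n (Finset.mem_range.1 hk)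
    exact (((hfm _ hk0).add (hfm _ hk1)).div_const 2).mul
      ((hm.aemeasurable hk1).sub (hm.aemeasurable hk0))
  · refine Finset.aemeasurable_fun_sum _ fun k hk => ?_
    have hk0 := π.mem_Icc n (Finset.mem_range.1 hk).le
    have hk1 := π.mem_Icc n (Finset.mem_range.1 hk)
    exact ((hm.aemeasurable hk1).sub (hm.aemeasurable hk0)).pow_const 2
  · obtain ⟨K, hK⟩ := hm.sum_sq_boundedInProbability hμ hη
    exact ⟨K, hK π⟩
  · filter_upwards [hJ, hm.2, hV.2] with ω hωJ hωm hωV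
    rw [Metric.tendsto_atTop]
    intro η hη
    obtain ⟨δ, hδ, h⟩ := exists_mesh_abs_trapezoidSum_sub_le hf hωm hωV.1 hωV.2 hωJ (half_pos hη)
    obtain ⟨n₀, hn₀⟩ := eventually_atTop.1 (π.mesh δ hδ)
    refine ⟨n₀, fun n hn => ?_⟩
    have hQ : 0 ≤ ∑ k ∈ Finset.range (π.j n), (m (π.pt n (k + 1)) ω - m (π.pt n k) ω) ^ 2 :=
      Finset.sum_nonneg fun k _ => sq_nonneg _
    have h2 := h (π.j n) (π.pt n) (π.pt_zero n) (π.pt_last n)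
      fun k hk => ⟨(π.pt_lt n k hk).le, hn₀ n hn k hk⟩
    rw [Real.dist_eq, sub_zero, abs_div, abs_of_pos (by linarith : (0 : ℝ) < 1 + _),
      div_lt_iff₀ (by linarith)]
    refine lt_of_le_of_lt h2 ?_
    gcongr
    linarith
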